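/- \textbf{Setting.} Formulas are generated from atomic propositions by $\bot,\top,\wedge,\vee,\supset,\square,\Diamond$. A \emph{bi-relational model} $\mathcal M=(W,\le,R,V)$ has a non-empty set $W$ of worlds, a pre-order $\le$, a binary relation $R$ on $W$ and a valuation $V$ by sets of atoms with the \emph{hereditary property} (HP): $x\le y$ implies $V(x)\subseteq V(y)$. It satisfies \emph{forward confluence} (FC) if $z\le x$ and $Rzy$ imply that there is $t$ with $Rxt$ and $y\le t$. Forcing is usual for atoms, $\bot,\top,\wedge,\vee$, and: $w\Vdash B\supset C$ iff for all $w'\ge w$, $w'\Vdash B$ implies $w'\Vdash C$; $w\Vdash\square B$ iff $v'\Vdash B$ whenever $w\le w'$ and $Rw'v'$; $w\Vdash\Diamond B$ iff $v\Vdash B$ for some $v$ with $Rwv$. A formula is \emph{valid} (in FIK) if it is forced at every world of every bi-relational model with (FC). \textbf{Calculus.} A \emph{sequent} is $\Gamma\Rightarrow\Delta$ with $\Gamma$ a finite set of formulas and $\Delta$ a finite set of formulas, modal blocks $[S]$ and implication blocks $\langle S\rangle$, $S$ a sequent. A context $G\{\}$ is a sequent with a hole, inside any number of nested blocks. $\Theta^*$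 is obtained from $\Theta$ by keeping only its modal blocks $[\Phi\Rightarrow\Psi]$ and replacing them by $[\Phi\Rightarrow\Psi^*]$; $\Theta^\sharp$ by deleting all implication blocks and replacing the modal blocks $[\Phi\Rightarrow\Psi]$ by $[\Phi\Rightarrow\Psi^\sharp]$. The calculus $\mathbf{CC}_{\mathrm{FIK}}$ has the axioms $G\{\Gamma,\bot\Rightarrow\Delta\}$, $G\{\Gamma\Rightarrow\top,\Delta\}$, $G\{\Gamma,A\Rightarrow A,\Delta\}$ and the following rules (conclusion $\leftarrow$ premises, inside any context): $(\wedge_L)$ $\Gamma,A\wedge B\Rightarrow\Delta\ \leftarrow\ \Gamma,A\wedge B,A,B\Rightarrow\Delta$; $(\wedge_R)$ $\Gamma\Rightarrow\Delta,A\wedge B\ \leftarrow\ \Gamma\Rightarrow\Delta,A\wedge B,A$ and $\Gamma\Rightarrow\Delta,A\wedge B,B$; $(\vee_L)$ $\Gamma,A\vee B\Rightarrow\Delta\ \leftarrow\ \Gamma,A\vee B,A\Rightarrow\Delta$ and $\Gamma,A\vee B,B\Rightarrow\Delta$; $(\vee_R)$ $\Gamma\Rightarrow\Delta,A\vee B\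 \leftarrow\ \Gamma\Rightarrow\Delta,A\vee B,A,B$; $(\supset_L)$ $\Gamma,A\supset B\Rightarrow\Delta\ \leftarrow\ \Gamma,A\supset B\Rightarrow A,\Delta$ and $\Gamma,A\supset B,B\Rightarrow\Delta$; $(\supset_R)$ $\Gamma\Rightarrow\Delta,A\supset B\ \leftarrow\ \Gamma\Rightarrow\Delta,A\supset B,B$ if $A\in\Gamma$, and $\leftarrow\ \Gamma\Rightarrow\Delta,A\supset B,\langle A\Rightarrow B\rangle$ if $A\notin\Gamma$; $(\square_L)$ $\Gamma,\square A\Rightarrow\Delta,[\Sigma\Rightarrow\Pi]\ \leftarrow\ \Gamma,\square A\Rightarrow\Delta,[\Sigma,A\Rightarrow\Pi]$; $(\square_R)$ $\Gamma\Rightarrow\Delta,\square A\ \leftarrow\ \Gamma\Rightarrow\Delta,\square A,\langle\Rightarrow[\Rightarrow A]\rangle$; $(\Diamond_L)$ $\Gamma,\Diamond A\Rightarrow\Delta\ \leftarrow\ \Gamma,\Diamond A\Rightarrow\Delta,[A\Rightarrow]$; $(\Diamond_R)$ $\Gamma\Rightarrow\Delta,\Diamond A,[\Sigma\Rightarrow\Pi]\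 \leftarrow\ \Gamma\Rightarrow\Delta,\Diamond A,[\Sigma\Rightarrow\Pi,A]$; (trans) $\Gamma,\Gamma'\Rightarrow\Delta,\langle\Sigma\Rightarrow\Pi\rangle\ \leftarrow\ \Gamma,\Gamma'\Rightarrow\Delta,\langle\Gamma',\Sigma\Rightarrow\Pi\rangle$; (inter) $\Gamma\Rightarrow\Delta,\langle\Sigma\Rightarrow\Pi\rangle,[\Lambda\Rightarrow\Theta]\ \leftarrow\ \Gamma\Rightarrow\Delta,\langle\Sigma\Rightarrow\Pi,[\Lambda\Rightarrow\Theta^*]\rangle,[\Lambda\Rightarrow\Theta]$. A derivation is a finite tree built from its root by these rules; a sequent is provable if it is the root of a derivation all of whose leaves are axioms. \textbf{Saturation.} \emph{Structural inclusion} $(\Gamma_1\Rightarrow\Delta_1)\subseteq^{\mathsf S}(\Gamma_2\Rightarrow\Delta_2)$ means, recursively, that $\Gamma_1\subseteq\Gamma_2$ and every $[S_1]\in\Delta_1$ has some $[S_2]\in\Delta_2$ with $S_1\subseteq^{\mathsf S}S_2$. Write $T\in^+S$ if $T$ is $S$ or occurs in $S$ inside nested blocks, and $T\in^{\langle\cdot\rangle}S$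 if $T$ is reached from $S$ by one or more implication blocks only. For $\Gamma\Rightarrow\Delta$, the saturation condition of $(\bot_L)$ is $\bot\notin\Gamma$; of $(\top_R)$ $\top\notin\Delta$; of (id) that no atom is in $\Gamma\cap\Delta$; of $(\wedge_L)$/$(\vee_R)$ that for $A\wedge B\in\Gamma$ / $A\vee B\in\Delta$ both $A,B$ are in $\Gamma$ / $\Delta$; of $(\vee_L)$/$(\wedge_R)$ that for $A\vee B\in\Gamma$ / $A\wedge B\in\Delta$ one of $A,B$ is in $\Gamma$ / $\Delta$; of $(\supset_L)$ that for $A\supset B\in\Gamma$, $A\in\Delta$ or $B\in\Gamma$; of $(\square_L)$ that for $\square A\in\Gamma$ and $[\Sigma\Rightarrow\Pi]\in\Delta$, $A\in\Sigma$; of $(\Diamond_R)$ that for $\Diamond A\in\Delta$ and $[\Sigma\Rightarrow\Pi]\in\Delta$, $A\in\Pi$; of $(\Diamond_L)$ that for $\Diamond A\in\Gamma$ there is $[\Sigma\Rightarrow\Pi]\in\Delta$ with $A\in\Sigma$ (all these are the (R1) conditions); of (trans) that $\Gamma\subseteq\Sigma$ for $\langle\Sigma\Rightarrow\Pi\rangle\in\Delta$;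 of (inter) that for $\langle\Sigma\Rightarrow\Pi\rangle,[U]\in\Delta$ there is $[U']\in\Pi$ with $U\subseteq^{\mathsf S}U'$ (the (R2) conditions); of $(\supset_R)$ that for $A\supset B\in\Delta$ either $A\in\Gamma$ and $B\in\Delta$, or some $\langle\Sigma\Rightarrow\Pi\rangle\in\Delta$ has $A\in\Sigma$, $B\in\Pi$; of $(\square_R)$ that for $\square A\in\Delta$ there is $[\Lambda\Rightarrow\Theta]$ with $A\in\Theta$ in $\Delta$ or in some $\Pi$ with $\langle\Sigma\Rightarrow\Pi\rangle\in\Delta$ (the (R3) conditions). A non-axiom $\Gamma\Rightarrow\Delta$ is R1-saturated if $\Gamma\Rightarrow\Delta^\sharp$ satisfies the (R1) conditions, R2-saturated if moreover it satisfies the (R2) conditions, R3-saturated if moreover it satisfies the (R3) conditions. $T=(\Gamma\Rightarrow\Delta)$ is \emph{blocked in} $S$ if there is an R3-saturated $S_1=(\Gamma_1\Rightarrow\Delta_1)\in^+S$ with $T\in^{\langle\cdot\rangle}S_1$, $\Gamma_1=\Gamma$ and $\Delta_1^\sharp=\Delta^\sharp$. A non-axiom $S$ is global-R1-saturated, global-R2-saturated,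 \emph{global-saturated} if each $T\in^+S$ is R1-, R2-, R3-saturated, respectively, or blocked in $S$. \emph{Proof search} for $\Rightarrow A$ builds derivations with root $\Rightarrow A$ under these restrictions: no rule is applied to an axiom; no rule is applied redundantly (that is, to formulas and blocks for which its saturation condition already holds); (trans) and (inter) are applied only to global-R1-saturated sequents; $(\supset_R)$ and $(\square_R)$ are applied only to global-R2-saturated sequents $G\{T\}$, with $T$ not blocked in $G\{T\}$. The search \emph{fails} if it yields a finite derivation each of whose leaves is an axiom or global-saturated, with at least one global-saturated leaf. For a sequent $S$ let $\mathcal M_S=(W_S,\le_S,R_S,V_S)$ with $W_S=\{x_T: T\in^+S\}$; $x_T\le_S x_U$ iff $T\subseteq^{\mathsf S}U$; $R_Sx_Tx_U$ iff $[U]$ is in the succedent of $T$; $V_S(x_{\Phi\Rightarrow\Psi})$ the set of atoms in $\Phi$. \textbf{Theorem.} Let $A$ be a formula. (1) (Completeness.) If $A$ is valid in FIK, then $\Rightarrow A$ is provable in $\mathbf{CC}_{\mathrm{FIK}}$. (2) If $\Rightarrow A$ is not provable in $\mathbf{CC}_{\mathrm{FIK}}$, then there is a failed proof search for $\Rightarrow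 A$; in particular, one with a global-saturated leaf. (3) (Countermodel extraction.) If $S$ is a global-saturated leaf of any $\mathbf{CC}_{\mathrm{FIK}}$-derivation with root $\Rightarrow A$, in particular of a failed proof search, then $\mathcal M_S$ is a finite bi-relational model that satisfies (HP) and (FC), and $\mathcal M_S,x_S\not\Vdash A$. (4) (Finite model property.) If $A$ is not valid in FIK, then $A$ fails at some world of some finite bi-relational model that satisfies (FC). -/

import Mathlib

universe u

namespace FIK

/-! ## Formulas and bi-relational semantics -/

/-- Formulas of the intuitionistic modal language over the atomic propositions `At`. -/
inductive Formula (At : Type u) : Type u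
  | atom (p : At)
  | bot
  | top
  | and (A B : Formula At)
  | or (A B : Formula At)
  | imp (A B : Formula At)
  | box (A : Formula At)
  | dia (A : Formula At)

noncomputable instance (At : Type u) : DecidableEq (Formula At) := Classical.decEq _

/-- A quadruple `(W, ≤, R, V)`; the conditions on it are stated separately below. -/
structure Model (At : Type u) where
  World : Type u
  le : World → World → Prop
  R : World → World → Prop
  V : World → Set At

/-- The hereditary property (HP). -/
def Model.Hereditary {At : Type u} (M : Model At) : Prop :=
  ∀ x y, M.le x y → M.V x ⊆ M.V y

/-- A bi-relational model: non-empty set of worlds, `≤` a pre-order, hereditary valuation. -/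
structure Model.IsBirelational {At : Type u} (M : Model At) : Prop where
  nonempty : Nonempty M.World
  le_refl : ∀ x, M.le x x
  le_trans : ∀ x y z, M.le x y → M.le y z → M.le x z
  hereditary : M.Hereditary

/-- Forward confluence (FC): if `x ≥ z` and `R z y`, then `R x t` and `t ≥ y` for some `t`. -/
def Model.ForwardConfluent {At : Type u} (M : Model At) : Prop :=
  ∀ x y, (∃ z, M.le z x ∧ M.R z y) → ∃ t, M.R x t ∧ M.le y t

/-- The forcing relation `M, w ⊩ A`. -/
def Forces {At : Type u} (M : Model At) : M.World → Formula At → Prop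
  | w, .atom p => p ∈ M.V w
  | _, .bot => False
  | _, .top => True
  | w, .and A B => Forces M w A ∧ Forces M w B
  | w, .or A B => Forces M w A ∨ Forces M w B
  | w, .imp A B => ∀ w', M.le w w' → Forces M w' A → Forces M w' B
  | w, .box A => ∀ w' v', M.le w w' → M.R w' v' → Forces M v' A
  | w, .dia A => ∃ v, M.R w v ∧ Forces M v A

/-- Validity: truth at every world of every forward confluent bi-relational model. -/
def Valid {At : Type u} (A : Formula At) : Prop :=
  ∀ M : Model At, M.IsBirelational → M.ForwardConfluent → ∀ w : M.World, Forces M w A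

/-! ## Set-based bi-nested sequents

A set-based sequent is `Γ ⇒ Δ` where `Γ` is a finite set of formulas and `Δ` is a finite set of
formulas, modal blocks `[S]` and implication blocks `⟨S⟩`, with `S` again set-based sequents.
The type of sequents is the initial algebra (least fixed point) of `SeqF`. -/

/-- One layer of a sequent: the antecedent, and the formulas, the modal blocks and the
implication blocks of the succedent. -/
@[ext]
structure SeqF (At X : Type u) : Type u where
  ant : Finset (Formula At)
  fml : Finset (Formula At)
  box : Finset X
  imp : Finset X

open Classical in
noncomputable instance (At : Type u) : Functor (SeqF At) where
  map f x := ⟨x.ant, x.fml, x.box.image f, x.imp.image f⟩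

open Classical in
/-- `SeqF` is a quotient of the functor of pairs of lists, so that it has an initial algebra. -/
noncomputable instance (At : Type u) : QPF.{u, u, u} (SeqF At) where
  P := ⟨Finset (Formula At) × Finset (Formula At) × ℕ × ℕ,
    fun a => ULift.{u} (Fin a.2.2.1) ⊕ ULift.{u} (Fin a.2.2.2)⟩
  abs p := ⟨p.1.1, p.1.2.1, Finset.univ.image fun i => p.2 (Sum.inl i),
    Finset.univ.image fun i => p.2 (Sum.inr i)⟩
  repr x := ⟨(x.ant, x.fml, x.box.toList.length, x.imp.toList.length),
    Sum.elim (fun i => x.box.toList.get i.down) (fun i => x.imp.toList.get i.down)⟩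
  abs_repr x := by
    ext a
    · rfl
    · rfl
    · simp only [Sum.elim_inl, Finset.mem_image, Finset.mem_univ, true_and]
      rw [← Finset.mem_toList, List.mem_iff_getElem]
      constructor
      · rintro ⟨i, hi⟩; exact ⟨i.1.1, i.1.2, hi⟩
      · rintro ⟨i, h, hi⟩; exact ⟨⟨⟨i, h⟩⟩, hi⟩
    · simp only [Sum.elim_inr, Finset.mem_image, Finset.mem_univ, true_and]
      rw [← Finset.mem_toList, List.mem_iff_getElem]
      constructor
      · rintro ⟨i, hi⟩; exact ⟨i.1.1, i.1.2, hi⟩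
      · rintro ⟨i, h, hi⟩; exact ⟨⟨⟨i, h⟩⟩, hi⟩
  abs_map f p := by
    obtain ⟨a, g⟩ := p
    simp [Functor.map, PFunctor.map, Finset.image_image, Function.comp_def]
    exact ⟨rfl, rfl⟩

/-- Set-based bi-nested sequents. -/
def Sequent (At : Type u) : Type u := QPF.Fix (SeqF At)

noncomputable instance (At : Type u) : DecidableEq (Sequent At) := Classical.decEq _

namespace Sequent

variable {At : Type u}

/-- The sequent with the given antecedent, succedent formulas, modal and implication blocks. -/
noncomputable def mk (ant fml : Finset (Formula At)) (box imp : Finset (Sequent At)) :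
    Sequent At :=
  QPF.Fix.mk (F := SeqF At) ⟨ant, fml, box, imp⟩

/-- The formulas of the antecedent. -/
noncomputable def ant (S : Sequent At) : Finset (Formula At) := (QPF.Fix.dest S : SeqF At _).ant

/-- The formulas of the succedent. -/
noncomputable def fml (S : Sequent At) : Finset (Formula At) := (QPF.Fix.dest S : SeqF At _).fml

/-- The sequents `T` such that the modal block `[T]` is in the succedent. -/
noncomputable def box (S : Sequent At) : Finset (Sequent At) := (QPF.Fix.dest S : SeqF At _).box

/-- The sequents `T` such that the implication block `⟨T⟩` is in the succedent. -/
noncomputable def imp (S : Sequent At) : Finset (Sequent At) := (QPF.Fix.dest S : SeqF At _).imp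

section basic
variable (Γ Δ : Finset (Formula At)) (m i : Finset (Sequent At))

@[simp] theorem ant_mk : (mk Γ Δ m i).ant = Γ := by
  unfold ant mk; rw [QPF.Fix.dest_mk]

@[simp] theorem fml_mk : (mk Γ Δ m i).fml = Δ := by
  unfold fml mk; rw [QPF.Fix.dest_mk]

@[simp] theorem box_mk : (mk Γ Δ m i).box = m := by
  unfold box mk; rw [QPF.Fix.dest_mk]

@[simp] theorem imp_mk : (mk Γ Δ m i).imp = i := by
  unfold imp mk; rw [QPF.Fix.dest_mk]

@[simp] theorem mk_eta (S : Sequent At) : mk S.ant S.fml S.box S.imp = S :=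
  QPF.Fix.mk_dest (F := SeqF At) S

/-- Structural induction on sequents. -/
theorem ind {p : Sequent At → Prop}
    (h : ∀ S : Sequent At, (∀ T ∈ S.box, p T) → (∀ T ∈ S.imp, p T) → p S) (S : Sequent At) :
    p S := by
  classical
  refine QPF.Fix.ind (F := SeqF At) p ?_ S
  rintro _ ⟨⟨Γ, Δ, m, i⟩, rfl⟩
  refine h (mk Γ Δ (m.image fun x => x.1) (i.image fun x => x.1)) ?_ ?_
  · intro T hT
    rw [box_mk] at hT
    obtain ⟨a, -, rfl⟩ := Finset.mem_image.mp hT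
    exact a.2
  · intro T hT
    rw [imp_mk] at hT
    obtain ⟨a, -, rfl⟩ := Finset.mem_image.mp hT
    exact a.2

end basic

/-- Recursion on sequents: the results for the blocks are computed first. -/
noncomputable def fold {X : Type u} (g : SeqF At X → X) (S : Sequent At) : X :=
  QPF.Fix.rec (F := SeqF At) g S

open Classical in
theorem fold_eq {X : Type u} (g : SeqF At X → X) (S : Sequent At) :
    fold g S = g ⟨S.ant, S.fml, S.box.image (fold g), S.imp.image (fold g)⟩ := by
  conv_lhs => rw [← mk_eta S]
  exact QPF.Fix.rec_eq (F := SeqF At) g ⟨S.ant, S.fml, S.box, S.imp⟩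

/-- `Λ ⇒ Θ ↦ Λ ⇒ Θ*`: all formulas and implication blocks of the succedent are dropped, here and
recursively in the modal blocks. -/
noncomputable def star : Sequent At → Sequent At :=
  fold fun x => mk x.ant ∅ x.box ∅

theorem star_eq (S : Sequent At) : S.star = mk S.ant ∅ (S.box.image star) ∅ := by
  rw [star, fold_eq]

/-- `Λ ⇒ Θ ↦ Λ ⇒ Θ♯`: all implication blocks are dropped, here and recursively in the modal
blocks. -/
noncomputable def sharp : Sequent At → Sequent At :=
  fold fun x => mk x.ant x.fml x.box ∅

theorem sharp_eq (S : Sequent At) : S.sharp = mk S.ant S.fml (S.box.image sharp) ∅ := by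
  rw [sharp, fold_eq]

/-- Structural inclusion; `structIncl_iff` is its defining recursive equation. -/
def StructIncl : Sequent At → Sequent At → Prop :=
  fold fun x T => x.ant ⊆ T.ant ∧ ∀ φ ∈ x.box, ∃ T' ∈ T.box, φ T'

theorem structIncl_iff (S T : Sequent At) : StructIncl S T ↔
    S.ant ⊆ T.ant ∧ ∀ S' ∈ S.box, ∃ T' ∈ T.box, StructIncl S' T' := by
  rw [StructIncl, fold_eq]
  simp only [Finset.mem_image, forall_exists_index, and_imp, forall_apply_eq_imp_iff₂]

/-- `A, Γ ⇒ Δ` from `Γ ⇒ Δ`. -/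
noncomputable def addL (S : Sequent At) (A : Formula At) : Sequent At :=
  mk (insert A S.ant) S.fml S.box S.imp

/-- `Γ', Γ ⇒ Δ` from `Γ ⇒ Δ`. -/
noncomputable def addSetL (S : Sequent At) (Γ' : Finset (Formula At)) : Sequent At :=
  mk (Γ' ∪ S.ant) S.fml S.box S.imp

/-- `Γ ⇒ Δ, A` from `Γ ⇒ Δ`. -/
noncomputable def addR (S : Sequent At) (A : Formula At) : Sequent At :=
  mk S.ant (insert A S.fml) S.box S.imp

/-- `Γ ⇒ Δ, [T]` from `Γ ⇒ Δ`. -/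
noncomputable def addBox (S T : Sequent At) : Sequent At :=
  mk S.ant S.fml (insert T S.box) S.imp

/-- `Γ ⇒ Δ, ⟨T⟩` from `Γ ⇒ Δ`. -/
noncomputable def addImp (S T : Sequent At) : Sequent At :=
  mk S.ant S.fml S.box (insert T S.imp)

/-- The empty sequent `⇒`. -/
noncomputable def empty : Sequent At := mk ∅ ∅ ∅ ∅

/-- The sequent `⇒ A`. -/
noncomputable def goal (A : Formula At) : Sequent At := empty.addR A

end Sequent

open Sequent

/-- Contexts `G{}`. -/
inductive Context (At : Type u) : Type u
  | hole
  | imp (S : Sequent At) (G : Context At)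
  | box (S : Sequent At) (G : Context At)

/-- `G{T}`. -/
noncomputable def Context.fill {At : Type u} : Context At → Sequent At → Sequent At
  | .hole, T => T
  | .imp S G, T => S.addImp (G.fill T)
  | .box S G, T => S.addBox (G.fill T)

/-! ## The cumulative calculus -/

/-- The axioms of the calculus: `G{Γ, ⊥ ⇒ Δ}`, `G{Γ ⇒ ⊤, Δ}` and `G{Γ, A ⇒ Δ, A}`. -/
inductive IsAxiom {At : Type u} : Sequent At → Prop
  | botL (G : Context At) (S : Sequent At) : IsAxiom (G.fill (S.addL .bot))
  | topR (G : Context At) (S : Sequent At) : IsAxiom (G.fill (S.addR .top))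
  | id (G : Context At) (S : Sequent At) (A : Formula At) : IsAxiom (G.fill ((S.addL A).addR A))

/-- Instances of the rules that have premises, without their context. In each of them `S` is the
side sequent `Γ ⇒ Δ`, and `T`, `U` are the sequents in the displayed blocks. -/
inductive Rule (At : Type u) : Type u
  | andL (S : Sequent At) (A B : Formula At)
  | andR (S : Sequent At) (A B : Formula At)
  | orL (S : Sequent At) (A B : Formula At)
  | orR (S : Sequent At) (A B : Formula At)
  | impL (S : Sequent At) (A B : Formula At)
  | impR₁ (S : Sequent At) (A B : Formula At)
  | impR₂ (S : Sequent At) (A B : Formula At)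
  | boxL (S : Sequent At) (A : Formula At) (T : Sequent At)
  | boxR (S : Sequent At) (A : Formula At)
  | diaL (S : Sequent At) (A : Formula At)
  | diaR (S : Sequent At) (A : Formula At) (T : Sequent At)
  | trans (S : Sequent At) (Γ' : Finset (Formula At)) (T : Sequent At)
  | inter (S T U : Sequent At)

namespace Rule

variable {At : Type u}

/-- The conclusion of a rule instance. -/
noncomputable def concl : Rule At → Sequent At
  | andL S A B => S.addL (.and A B)
  | andR S A B => S.addR (.and A B)
  | orL S A B => S.addL (.or A B)
  | orR S A B => S.addR (.or A B)
  | impL S A B => S.addL (.imp A B)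
  | impR₁ S A B => S.addR (.imp A B)
  | impR₂ S A B => S.addR (.imp A B)
  | boxL S A T => (S.addL (.box A)).addBox T
  | boxR S A => S.addR (.box A)
  | diaL S A => S.addL (.dia A)
  | diaR S A T => (S.addR (.dia A)).addBox T
  | trans S Γ' T => (S.addSetL Γ').addImp T
  | inter S T U => (S.addImp T).addBox U

/-- The premises of a rule instance. -/
noncomputable def prems : Rule At → List (Sequent At)
  | andL S A B => [((S.addL (.and A B)).addL B).addL A]
  | andR S A B => [(S.addR (.and A B)).addR A, (S.addR (.and A B)).addR B]
  | orL S A B => [(S.addL (.or A B)).addL A, (S.addL (.or A B)).addL B]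
  | orR S A B => [((S.addR (.or A B)).addR A).addR B]
  | impL S A B => [(S.addL (.imp A B)).addR A, (S.addL (.imp A B)).addL B]
  | impR₁ S A B => [(S.addR (.imp A B)).addR B]
  | impR₂ S A B => [(S.addR (.imp A B)).addImp ((empty.addL A).addR B)]
  | boxL S A T => [(S.addL (.box A)).addBox (T.addL A)]
  | boxR S A => [(S.addR (.box A)).addImp (empty.addBox (empty.addR A))]
  | diaL S A => [(S.addL (.dia A)).addBox (empty.addL A)]
  | diaR S A T => [(S.addR (.dia A)).addBox (T.addR A)]
  | trans S Γ' T => [(S.addSetL Γ').addImp (T.addSetL Γ')]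
  | inter S T U => [(S.addImp (T.addBox U.star)).addBox U]

/-- The side conditions of the two right rules for implication. -/
def Side : Rule At → Prop
  | impR₁ S A _ => A ∈ S.ant
  | impR₂ S A _ => A ∉ S.ant
  | _ => True

end Rule

/-- `Derivation ok S L`: there is a finite derivation with root `S` and set of leaves `L` (built
from the root upwards) in which every rule application, given by its context and its rule
instance, satisfies `ok`. -/
inductive Derivation {At : Type u} (ok : Context At → Rule At → Prop) :
    Sequent At → Set (Sequent At) → Prop
  | leaf (S : Sequent At) : Derivation ok S {S}
  | node (G : Context At) (r : Rule At) (L : Fin r.prems.length → Set (Sequent At)) :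
      r.Side → ok G r → (∀ i, Derivation ok (G.fill (r.prems.get i)) (L i)) →
      Derivation ok (G.fill r.concl) (⋃ i, L i)

/-- Derivations of the calculus without any further restriction. -/
def CCDerivation {At : Type u} (S : Sequent At) (L : Set (Sequent At)) : Prop :=
  Derivation (fun _ _ => True) S L

/-- Provability: there is a derivation all of whose leaves are axioms. -/
def Provable {At : Type u} (S : Sequent At) : Prop :=
  ∃ L, CCDerivation S L ∧ ∀ T ∈ L, IsAxiom T

/-! ## Saturation, blocking -/

namespace Sequent

variable {At : Type u}

/-- `T ∈^⟨·⟩ S`: transitive closure of "`⟨T⟩` is in the succedent of `S`". -/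
def InImp : Sequent At → Sequent At → Prop :=
  Relation.TransGen fun T S => T ∈ S.imp

/-- `T ∈^+ S`: reflexive-transitive closure of "`⟨T⟩` or `[T]` is in the succedent of `S`". -/
def InPlus : Sequent At → Sequent At → Prop :=
  Relation.ReflTransGen fun T S => T ∈ S.imp ∨ T ∈ S.box

/-- Block-equivalence `S ≃ T`. -/
def BlockEquiv (S T : Sequent At) : Prop := S.ant = T.ant ∧ S.sharp = T.sharp

/-- The saturation conditions of the rules (R1): all propositional and modal rules except the
right rules for implication and box. -/
structure CondR1 (S : Sequent At) : Prop where
  botL : Formula.bot ∉ S.ant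
  topR : Formula.top ∉ S.fml
  id : ∀ p : At, ¬ (Formula.atom p ∈ S.ant ∧ Formula.atom p ∈ S.fml)
  andR : ∀ A B, Formula.and A B ∈ S.fml → A ∈ S.fml ∨ B ∈ S.fml
  andL : ∀ A B, Formula.and A B ∈ S.ant → A ∈ S.ant ∧ B ∈ S.ant
  orR : ∀ A B, Formula.or A B ∈ S.fml → A ∈ S.fml ∧ B ∈ S.fml
  orL : ∀ A B, Formula.or A B ∈ S.ant → A ∈ S.ant ∨ B ∈ S.ant
  impL : ∀ A B, Formula.imp A B ∈ S.ant → A ∈ S.fml ∨ B ∈ S.ant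
  boxL : ∀ A, Formula.box A ∈ S.ant → ∀ T ∈ S.box, A ∈ T.ant
  diaR : ∀ A, Formula.dia A ∈ S.fml → ∀ T ∈ S.box, A ∈ T.fml
  diaL : ∀ A, Formula.dia A ∈ S.ant → ∃ T ∈ S.box, A ∈ T.ant

/-- The saturation conditions of (trans) and (inter). -/
structure CondR2 (S : Sequent At) : Prop where
  trans : ∀ T ∈ S.imp, S.ant ⊆ T.ant
  inter : ∀ T ∈ S.imp, ∀ U ∈ S.box, ∃ U' ∈ T.box, StructIncl U U'

/-- The saturation condition of the right rule for implication, for the formula `A ⊃ B`. -/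
def SatImpR (S : Sequent At) (A B : Formula At) : Prop :=
  (A ∈ S.ant ∧ B ∈ S.fml) ∨ ∃ T ∈ S.imp, A ∈ T.ant ∧ B ∈ T.fml

/-- The saturation condition of the right rule for box, for the formula `□A`. -/
def SatBoxR (S : Sequent At) (A : Formula At) : Prop :=
  (∃ U ∈ S.box, A ∈ U.fml) ∨ ∃ T ∈ S.imp, ∃ U ∈ T.box, A ∈ U.fml

/-- The saturation conditions of the rules (R3). -/
structure CondR3 (S : Sequent At) : Prop where
  impR : ∀ A B, Formula.imp A B ∈ S.fml → S.SatImpR A B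
  boxR : ∀ A, Formula.box A ∈ S.fml → S.SatBoxR A

def R1Saturated (S : Sequent At) : Prop := ¬ IsAxiom S ∧ S.sharp.CondR1

def R2Saturated (S : Sequent At) : Prop := S.R1Saturated ∧ S.CondR2

def R3Saturated (S : Sequent At) : Prop := S.R2Saturated ∧ S.CondR3

/-- `T` is blocked in `S`: some R3-saturated `S₁ ∈^+ S` satisfies `T ∈^⟨·⟩ S₁` and `S₁ ≃ T`. -/
def Blocked (T S : Sequent At) : Prop :=
  ∃ S₁, S₁.InPlus S ∧ S₁.R3Saturated ∧ T.InImp S₁ ∧ BlockEquiv S₁ T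

def GlobalR1Saturated (S : Sequent At) : Prop :=
  ¬ IsAxiom S ∧ ∀ T, InPlus T S → T.R1Saturated ∨ T.Blocked S

def GlobalR2Saturated (S : Sequent At) : Prop :=
  ¬ IsAxiom S ∧ ∀ T, InPlus T S → T.R2Saturated ∨ T.Blocked S

def GlobalSaturated (S : Sequent At) : Prop :=
  ¬ IsAxiom S ∧ ∀ T, InPlus T S → T.R3Saturated ∨ T.Blocked S

end Sequent

/-! ## Proof search -/

/-- A rule application is redundant if its conclusion already satisfies the saturation condition
of the rule for the formulas and blocks to which the rule is applied. -/
def Rule.Redundant {At : Type u} (r : Rule At) : Prop :=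
  match r with
  | andL _ A B => A ∈ r.concl.ant ∧ B ∈ r.concl.ant
  | andR _ A B => A ∈ r.concl.fml ∨ B ∈ r.concl.fml
  | orL _ A B => A ∈ r.concl.ant ∨ B ∈ r.concl.ant
  | orR _ A B => A ∈ r.concl.fml ∧ B ∈ r.concl.fml
  | impL _ A B => A ∈ r.concl.fml ∨ B ∈ r.concl.ant
  | impR₁ _ A B => r.concl.SatImpR A B
  | impR₂ _ A B => r.concl.SatImpR A B
  | boxL _ A T => A ∈ T.ant
  | boxR _ A => r.concl.SatBoxR A
  | diaL _ A => ∃ T ∈ r.concl.box, A ∈ T.ant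
  | diaR _ A T => A ∈ T.fml
  | trans _ Γ' T => Γ' ⊆ T.ant
  | inter _ T U => ∃ U' ∈ T.box, StructIncl U U'

/-- The conditions on a rule application that depend on the group of the rule: (R2) rules are
applied to global-R1-saturated sequents only; (R3) rules are applied to global-R2-saturated
sequents only, and never to a blocked component. -/
def Rule.Stage {At : Type u} (G : Context At) (r : Rule At) : Prop :=
  match r with
  | trans .. | inter .. => (G.fill r.concl).GlobalR1Saturated
  | impR₁ .. | impR₂ .. | boxR .. =>
      (G.fill r.concl).GlobalR2Saturated ∧ ¬ r.concl.Blocked (G.fill r.concl)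
  | _ => True

/-- The rule applications that proof search allows: no rule is applied to an axiom, no rule is
applied redundantly, and the order of the three groups of rules is respected. -/
def SearchStep {At : Type u} (G : Context At) (r : Rule At) : Prop :=
  ¬ IsAxiom (G.fill r.concl) ∧ ¬ r.Redundant ∧ r.Stage G

/-- Proof search for `⇒ A` fails with set of leaves `L`: `L` is the set of leaves of a finite
derivation with root `⇒ A` that is built by search steps, every leaf is an axiom or
global-saturated, and some leaf is global-saturated (hence not an axiom). -/
def FailedSearch {At : Type u} (A : Formula At) (L : Set (Sequent At)) : Prop :=
  Derivation SearchStep (goal A) L ∧ (∀ S ∈ L, IsAxiom S ∨ S.GlobalSaturated) ∧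
    ∃ S ∈ L, S.GlobalSaturated

/-! ## The model determined by a sequent -/

/-- The model `M_S`. -/
def seqModel {At : Type u} (S : Sequent At) : Model At where
  World := {T : Sequent At // T.InPlus S}
  le x y := StructIncl x.1 y.1
  R x y := y.1 ∈ x.1.box
  V x := {p | Formula.atom p ∈ x.1.ant}

/-- The world `x_S` of `M_S`. -/
def seqModelRoot {At : Type u} (S : Sequent At) : (seqModel S).World :=
  ⟨S, Relation.ReflTransGen.refl⟩

end FIK

/-!
Completeness, countermodel extraction and the finite model property of FIK.

*Countermodels.* Structural inclusion does not look at implication blocks, so two components with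
equal `sharp` are equivalent worlds of `M_S`. Hence a blocked component may be exchanged for the
R3-saturated one that blocks it, and the truth lemma `GlobalSaturated.forces` holds at every
component of a global-saturated sequent. Forward confluence of `M_S` is immediate from the
definition of structural inclusion.

*Soundness.* `Refutes` extends forcing to sequents; a world that refutes the conclusion of a rule
refutes one of its premises (`Rule.exists_refutes`), and no world refutes an axiom. This gives the
finite model property, since an invalid formula is then unprovable.

*Termination of proof search.* The search alternates two kinds of steps.

In a stable sequent (`Stable`) the only rules that may still be applicable are those that create an
implication block `⟨C⟩` in some component `T`. One of them is applied, at a component `T` that is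
neither blocked nor R3-saturated and has maximal height, and then the new block is saturated by the
remaining rules (`reach_stable`). This changes `C` only: the implication rule that adds no block is
never blocked there, since a component equivalent to an R3-saturated one already satisfies its
condition. So the `sharp` of the other components is unchanged, and the result is stable again.

The choice of `T` maintains the invariant `TopDown`: those components on a chain of implication
blocks that have implication blocks of their own have pairwise different `sharp`. There are only
finitely many of these over the subformulas of the given formula (`finite_impFree_bdd`), and the
nesting of modal blocks is bounded by the modal degree (`Bdd`). Therefore the depth at which implication blocks are created is bounded
(`Context.len_add_card_le`). For sequents of bounded depth, `weight` is a natural number that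
decreases in every step: it counts the persistent properties that the components still lack, each
of them weighted by more than the total weight of any block that could be added to provide it. As
succedents are sets, blocks may be identified when they become equal, but this can only lower the
weight.
-/

namespace FIK

open Sequent

variable {At : Type u}

/-! ### Sequents, components and contexts -/

namespace Sequent

theorem ext_parts {S T : Sequent At} (h₁ : S.ant = T.ant) (h₂ : S.fml = T.fml)
    (h₃ : S.box = T.box) (h₄ : S.imp = T.imp) : S = T := by
  rw [← mk_eta S, ← mk_eta T, h₁, h₂, h₃, h₄]

section simps
variable (S T : Sequent At) (A : Formula At) (Γ : Finset (Formula At))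

@[simp] theorem ant_addL : (S.addL A).ant = insert A S.ant := by simp [addL]
@[simp] theorem fml_addL : (S.addL A).fml = S.fml := by simp [addL]
@[simp] theorem box_addL : (S.addL A).box = S.box := by simp [addL]
@[simp] theorem imp_addL : (S.addL A).imp = S.imp := by simp [addL]
@[simp] theorem ant_addR : (S.addR A).ant = S.ant := by simp [addR]
@[simp] theorem fml_addR : (S.addR A).fml = insert A S.fml := by simp [addR]
@[simp] theorem box_addR : (S.addR A).box = S.box := by simp [addR]
@[simp] theorem imp_addR : (S.addR A).imp = S.imp := by simp [addR]
@[simp] theorem ant_addSetL : (S.addSetL Γ).ant = Γ ∪ S.ant := by simp [addSetL]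
@[simp] theorem fml_addSetL : (S.addSetL Γ).fml = S.fml := by simp [addSetL]
@[simp] theorem box_addSetL : (S.addSetL Γ).box = S.box := by simp [addSetL]
@[simp] theorem imp_addSetL : (S.addSetL Γ).imp = S.imp := by simp [addSetL]
@[simp] theorem ant_addBox : (S.addBox T).ant = S.ant := by simp [addBox]
@[simp] theorem fml_addBox : (S.addBox T).fml = S.fml := by simp [addBox]
@[simp] theorem box_addBox : (S.addBox T).box = insert T S.box := by simp [addBox]
@[simp] theorem imp_addBox : (S.addBox T).imp = S.imp := by simp [addBox]
@[simp] theorem ant_addImp : (S.addImp T).ant = S.ant := by simp [addImp]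
@[simp] theorem fml_addImp : (S.addImp T).fml = S.fml := by simp [addImp]
@[simp] theorem box_addImp : (S.addImp T).box = S.box := by simp [addImp]
@[simp] theorem imp_addImp : (S.addImp T).imp = insert T S.imp := by simp [addImp]
@[simp] theorem ant_empty : (empty : Sequent At).ant = ∅ := by simp [empty]
@[simp] theorem fml_empty : (empty : Sequent At).fml = ∅ := by simp [empty]
@[simp] theorem box_empty : (empty : Sequent At).box = ∅ := by simp [empty]
@[simp] theorem imp_empty : (empty : Sequent At).imp = ∅ := by simp [empty]
@[simp] theorem ant_sharp : S.sharp.ant = S.ant := by rw [sharp_eq]; simp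
@[simp] theorem fml_sharp : S.sharp.fml = S.fml := by rw [sharp_eq]; simp
@[simp] theorem box_sharp : S.sharp.box = S.box.image sharp := by rw [sharp_eq]; simp
@[simp] theorem imp_sharp : S.sharp.imp = ∅ := by rw [sharp_eq]; simp
@[simp] theorem ant_star : S.star.ant = S.ant := by rw [star_eq]; simp
@[simp] theorem fml_star : S.star.fml = ∅ := by rw [star_eq]; simp
@[simp] theorem box_star : S.star.box = S.box.image star := by rw [star_eq]; simp
@[simp] theorem imp_star : S.star.imp = ∅ := by rw [star_eq]; simp

end simps

theorem addL_of_mem {S : Sequent At} {A : Formula At} (h : A ∈ S.ant) : S.addL A = S := by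
  apply ext_parts <;> simp [h]

theorem addR_of_mem {S : Sequent At} {A : Formula At} (h : A ∈ S.fml) : S.addR A = S := by
  apply ext_parts <;> simp [h]

theorem addBox_of_mem {S T : Sequent At} (h : T ∈ S.box) : S.addBox T = S := by
  apply ext_parts <;> simp [h]

theorem addSetL_of_subset {S : Sequent At} {Γ : Finset (Formula At)} (h : Γ ⊆ S.ant) :
    S.addSetL Γ = S := by
  apply ext_parts <;> simp [h]

/-- `S` without the modal block `[T]`. -/
noncomputable def eraseBox (S T : Sequent At) : Sequent At :=
  mk S.ant S.fml (S.box.erase T) S.imp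

/-- `S` without the implication block `⟨T⟩`. -/
noncomputable def eraseImp (S T : Sequent At) : Sequent At :=
  mk S.ant S.fml S.box (S.imp.erase T)

section simps
variable (S T : Sequent At)
@[simp] theorem ant_eraseBox : (S.eraseBox T).ant = S.ant := by simp [eraseBox]
@[simp] theorem fml_eraseBox : (S.eraseBox T).fml = S.fml := by simp [eraseBox]
@[simp] theorem box_eraseBox : (S.eraseBox T).box = S.box.erase T := by simp [eraseBox]
@[simp] theorem imp_eraseBox : (S.eraseBox T).imp = S.imp := by simp [eraseBox]
@[simp] theorem ant_eraseImp : (S.eraseImp T).ant = S.ant := by simp [eraseImp]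
@[simp] theorem fml_eraseImp : (S.eraseImp T).fml = S.fml := by simp [eraseImp]
@[simp] theorem box_eraseImp : (S.eraseImp T).box = S.box := by simp [eraseImp]
@[simp] theorem imp_eraseImp : (S.eraseImp T).imp = S.imp.erase T := by simp [eraseImp]
end simps

theorem eraseBox_addBox {S T : Sequent At} (h : T ∈ S.box) : (S.eraseBox T).addBox T = S := by
  apply ext_parts <;> simp [h]

theorem eraseImp_addImp {S T : Sequent At} (h : T ∈ S.imp) : (S.eraseImp T).addImp T = S := by
  apply ext_parts <;> simp [h]

@[simp] theorem sharp_sharp (S : Sequent At) : S.sharp.sharp = S.sharp := by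
  induction S using Sequent.ind with
  | h S ihb _ =>
    apply ext_parts <;> simp only [ant_sharp, fml_sharp, imp_sharp, box_sharp]
    rw [Finset.image_image]
    exact Finset.image_congr fun T hT => ihb T hT

theorem sharp_addImp (S T : Sequent At) : (S.addImp T).sharp = S.sharp := by
  apply ext_parts <;> simp

/-! ### Structural inclusion -/

theorem StructIncl.refl (S : Sequent At) : StructIncl S S := by
  induction S using Sequent.ind with
  | h S ihb _ => exact (structIncl_iff _ _).2 ⟨subset_rfl, fun T hT => ⟨T, hT, ihb T hT⟩⟩

theorem StructIncl.trans {S T U : Sequent At} (h₁ : StructIncl S T) (h₂ : StructIncl T U) :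
    StructIncl S U := by
  induction S using Sequent.ind generalizing T U with
  | h S ihb _ =>
    rw [structIncl_iff] at h₁ h₂ ⊢
    refine ⟨h₁.1.trans h₂.1, fun S' hS' => ?_⟩
    obtain ⟨T', hT', h⟩ := h₁.2 S' hS'
    obtain ⟨U', hU', h'⟩ := h₂.2 T' hT'
    exact ⟨U', hU', ihb S' hS' h h'⟩

theorem structIncl_sharp_right (S T : Sequent At) : StructIncl S T.sharp ↔ StructIncl S T := by
  induction S using Sequent.ind generalizing T with
  | h S ihb _ =>
    rw [structIncl_iff, structIncl_iff]
    simp only [ant_sharp, box_sharp, Finset.mem_image, exists_exists_and_eq_and]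
    refine and_congr_right fun _ => forall₂_congr fun U hU => ?_
    exact exists_congr fun V => and_congr_right fun _ => ihb U hU V

theorem structIncl_sharp_left (S T : Sequent At) : StructIncl S.sharp T ↔ StructIncl S T := by
  have h : StructIncl S S.sharp := (structIncl_sharp_right S S).2 (.refl S)
  have h' : StructIncl S.sharp S := (structIncl_sharp_right _ _).1 (.refl _)
  exact ⟨h.trans, h'.trans⟩

/-- Structural inclusion does not see implication blocks. -/
theorem structIncl_congr {S S' T T' : Sequent At} (hS : S.sharp = S'.sharp)
    (hT : T.sharp = T'.sharp) : StructIncl S T ↔ StructIncl S' T' := by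
  rw [← structIncl_sharp_left, ← structIncl_sharp_right, hS, hT, structIncl_sharp_left,
    structIncl_sharp_right]

theorem structIncl_of_sharp_eq {S T : Sequent At} (h : S.sharp = T.sharp) : StructIncl S T :=
  (structIncl_congr h rfl).2 (.refl T)

theorem structIncl_star_right (S : Sequent At) : StructIncl S S.star := by
  induction S using Sequent.ind with
  | h S ihb _ =>
    rw [structIncl_iff]
    simp only [ant_star, box_star, Finset.mem_image, exists_exists_and_eq_and]
    exact ⟨subset_rfl, fun T hT => ⟨T, hT, ihb T hT⟩⟩

/-- A sequent satisfies the conditions of (trans) and (inter) iff it is structurally included in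
each of its implication blocks. -/
theorem condR2_iff {S : Sequent At} : S.CondR2 ↔ ∀ T ∈ S.imp, StructIncl S T := by
  constructor
  · exact fun h T hT => (structIncl_iff _ _).2 ⟨h.trans T hT, h.inter T hT⟩
  · exact fun h => ⟨fun T hT => ((structIncl_iff _ _).1 (h T hT)).1,
      fun T hT => ((structIncl_iff _ _).1 (h T hT)).2⟩

theorem ant_eq_of_sharp_eq {S T : Sequent At} (h : S.sharp = T.sharp) : S.ant = T.ant := by
  rw [← ant_sharp S, h, ant_sharp]

theorem fml_eq_of_sharp_eq {S T : Sequent At} (h : S.sharp = T.sharp) : S.fml = T.fml := by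
  rw [← fml_sharp S, h, fml_sharp]

theorem condR1_sharp_iff {S : Sequent At} : S.sharp.CondR1 ↔ S.CondR1 := by
  have e1 : (∀ A, Formula.box A ∈ S.ant → ∀ T ∈ S.box.image sharp, A ∈ T.ant) ↔
      ∀ A, Formula.box A ∈ S.ant → ∀ T ∈ S.box, A ∈ T.ant := by
    simp only [Finset.forall_mem_image, ant_sharp]
  have e2 : (∀ A, Formula.dia A ∈ S.fml → ∀ T ∈ S.box.image sharp, A ∈ T.fml) ↔
      ∀ A, Formula.dia A ∈ S.fml → ∀ T ∈ S.box, A ∈ T.fml := by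
    simp only [Finset.forall_mem_image, fml_sharp]
  have e3 : (∀ A, Formula.dia A ∈ S.ant → ∃ T ∈ S.box.image sharp, A ∈ T.ant) ↔
      ∀ A, Formula.dia A ∈ S.ant → ∃ T ∈ S.box, A ∈ T.ant := by
    simp only [Finset.mem_image, exists_exists_and_eq_and, ant_sharp]
  constructor <;> rintro ⟨h1, h2, h3, h4, h5, h6, h7, h8, h9, h10, h11⟩
  · simp only [ant_sharp, fml_sharp, box_sharp] at *
    exact ⟨h1, h2, h3, h4, h5, h6, h7, h8, e1.1 h9, e2.1 h10, e3.1 h11⟩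
  · constructor <;> simp only [ant_sharp, fml_sharp, box_sharp]
    exacts [h1, h2, h3, h4, h5, h6, h7, h8, e1.2 h9, e2.2 h10, e3.2 h11]

/-! ### Components -/

theorem inPlus_iff {T S : Sequent At} :
    T.InPlus S ↔ T = S ∨ (∃ U ∈ S.imp, T.InPlus U) ∨ ∃ U ∈ S.box, T.InPlus U := by
  constructor
  · intro h
    rcases Relation.ReflTransGen.cases_tail h with h | ⟨U, h, hU⟩
    · exact .inl h.symm
    · rcases hU with hU | hU
      exacts [.inr (.inl ⟨U, hU, h⟩), .inr (.inr ⟨U, hU, h⟩)]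
  · rintro (rfl | ⟨U, hU, h⟩ | ⟨U, hU, h⟩)
    exacts [.refl, .tail h (.inl hU), .tail h (.inr hU)]

theorem InPlus.imp {S T U : Sequent At} (h : T.InPlus U) (hU : U ∈ S.imp) : T.InPlus S :=
  .tail h (.inl hU)

theorem InPlus.box {S T U : Sequent At} (h : T.InPlus U) (hU : U ∈ S.box) : T.InPlus S :=
  .tail h (.inr hU)

theorem InPlus.of_imp {S T U : Sequent At} (h : T.InPlus S) (hU : U ∈ T.imp) : U.InPlus S :=
  .head (.inl hU) h

theorem InPlus.of_box {S T U : Sequent At} (h : T.InPlus S) (hU : U ∈ T.box) : U.InPlus S :=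
  .head (.inr hU) h

theorem InImp.imp_nonempty {S T : Sequent At} (h : T.InImp S) : S.imp.Nonempty := by
  cases h with
  | single h => exact ⟨_, h⟩
  | tail _ h => exact ⟨_, h⟩

theorem finite_inPlus (S : Sequent At) : {T : Sequent At | T.InPlus S}.Finite := by
  induction S using Sequent.ind with
  | h S ihb ihi =>
    have : {T : Sequent At | T.InPlus S} =
        {S} ∪ ((⋃ U ∈ S.imp, {T | T.InPlus U}) ∪ ⋃ U ∈ S.box, {T | T.InPlus U}) := by
      ext T
      simp only [Set.mem_ofPred_eq, Set.mem_union, Set.mem_singleton_iff, Set.mem_iUnion,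
        exists_prop]
      exact inPlus_iff
    rw [this]
    exact (Set.finite_singleton S).union
      ((S.imp.finite_toSet.biUnion ihi).union (S.box.finite_toSet.biUnion ihb))

/-- The nesting depth of implication and modal blocks. -/
noncomputable def height (S : Sequent At) : ℕ :=
  (fold (X := ULift.{u} ℕ)
    (fun x => ⟨max (x.box.sup ULift.down) (x.imp.sup ULift.down) + 1⟩) S).down

theorem height_lt_of_imp {S T : Sequent At} (h : T ∈ S.imp) : T.height < S.height := by
  unfold height
  conv_rhs => rw [fold_eq]
  refine Nat.lt_succ_of_le (le_max_of_le_right (Finset.le_sup (f := ULift.down) ?_))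
  exact (@Finset.mem_image _ _ (fun _ _ => Classical.propDecidable _) _ _ _).2 ⟨T, h, rfl⟩

theorem InImp.height_lt {S T : Sequent At} (h : T.InImp S) : T.height < S.height := by
  induction h with
  | single h => exact height_lt_of_imp h
  | tail _ h ih => exact ih.trans (height_lt_of_imp h)

end Sequent

namespace Context

/-- Composition of contexts: `G{H{}}`. -/
def comp : Context At → Context At → Context At
  | .hole, H => H
  | .imp S G, H => .imp S (G.comp H)
  | .box S G, H => .box S (G.comp H)

/-- The number of blocks around the hole. -/
def len : Context At → ℕ
  | .hole => 0
  | .imp _ G => G.len + 1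
  | .box _ G => G.len + 1

/-- None of the side sequents of `G{}` contains the block that is displayed in `G{T}`. As
succedents are sets, this is what makes filling the hole with another sequent a replacement. -/
def Fresh (T : Sequent At) : Context At → Prop
  | .hole => True
  | .imp S G => G.fill T ∉ S.imp ∧ G.Fresh T
  | .box S G => G.fill T ∉ S.box ∧ G.Fresh T

theorem fill_comp (G H : Context At) (T : Sequent At) :
    (G.comp H).fill T = G.fill (H.fill T) := by
  induction G with
  | hole => rfl
  | imp S G ih => simp [comp, fill, ih]
  | box S G ih => simp [comp, fill, ih]

theorem inPlus_fill (G : Context At) (T : Sequent At) : T.InPlus (G.fill T) := by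
  induction G with
  | hole => exact .refl
  | imp S G ih => exact ih.imp (by simp [fill])
  | box S G ih => exact ih.box (by simp [fill])

theorem exists_fill {T S : Sequent At} (h : T.InPlus S) : ∃ G : Context At, G.fill T = S := by
  induction h with
  | refl => exact ⟨.hole, rfl⟩
  | @tail U S _ hU ih =>
    obtain ⟨G, rfl⟩ := ih
    rcases hU with hU | hU
    · exact ⟨.imp (S.eraseImp _) G, eraseImp_addImp hU⟩
    · exact ⟨.box (S.eraseBox _) G, eraseBox_addBox hU⟩

theorem sharp_fill_congr (G : Context At) {T T' : Sequent At} (h : T.sharp = T'.sharp) :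
    (G.fill T).sharp = (G.fill T').sharp := by
  induction G with
  | hole => exact h
  | imp S G ih => simp only [fill, sharp_addImp]
  | box S G ih => apply ext_parts <;> simp [fill, Finset.image_insert, ih]

end Context

theorem IsAxiom.of_inPlus {T S : Sequent At} (hT : IsAxiom T) (h : T.InPlus S) : IsAxiom S := by
  obtain ⟨G, rfl⟩ := Context.exists_fill h
  cases hT with
  | botL H U => rw [← Context.fill_comp]; exact .botL _ _
  | topR H U => rw [← Context.fill_comp]; exact .topR _ _
  | id H U A => rw [← Context.fill_comp]; exact .id _ _ _

theorem isAxiom_of_bot_mem {S : Sequent At} (h : .bot ∈ S.ant) : IsAxiom S := by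
  simpa [Context.fill, addL_of_mem h] using IsAxiom.botL .hole S

theorem isAxiom_of_top_mem {S : Sequent At} (h : .top ∈ S.fml) : IsAxiom S := by
  simpa [Context.fill, addR_of_mem h] using IsAxiom.topR .hole S

theorem isAxiom_of_mem {S : Sequent At} {A : Formula At} (h : A ∈ S.ant) (h' : A ∈ S.fml) :
    IsAxiom S := by
  simpa [Context.fill, addL_of_mem h, addR_of_mem h'] using IsAxiom.id .hole S A

/-! ### Derivations -/

theorem Derivation.mono {ok ok' : Context At → Rule At → Prop} (h : ∀ G r, ok G r → ok' G r)
    {S : Sequent At} {L : Set (Sequent At)} (d : Derivation ok S L) : Derivation ok' S L := by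
  induction d with
  | leaf S => exact .leaf S
  | node G r L hs hok _ ih => exact .node G r L hs (h _ _ hok) ih

/-- Proof search can be run from `S` to leaves that all satisfy `P`. -/
def Reach (P : Sequent At → Prop) (S : Sequent At) : Prop :=
  ∃ L, Derivation SearchStep S L ∧ ∀ T ∈ L, P T

theorem Reach.leaf {P : Sequent At → Prop} {S : Sequent At} (h : P S) : Reach P S :=
  ⟨{S}, .leaf S, by simpa using h⟩

theorem Reach.node {P : Sequent At → Prop} (G : Context At) (r : Rule At) (hs : r.Side)
    (hok : SearchStep G r) (h : ∀ T ∈ r.prems, Reach P (G.fill T)) :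
    Reach P (G.fill r.concl) := by
  choose L hL hP using fun i : Fin r.prems.length => h (r.prems.get i) (List.get_mem _ _)
  refine ⟨_, .node G r L hs hok hL, ?_⟩
  simp only [Set.mem_iUnion, forall_exists_index]
  exact fun T i hT => hP i T hT

theorem Reach.bind {P Q : Sequent At → Prop} {S : Sequent At} (h : Reach P S)
    (hPQ : ∀ T, P T → Reach Q T) : Reach Q S := by
  obtain ⟨L, d, hL⟩ := h
  induction d with
  | leaf S => exact hPQ S (hL S rfl)
  | node G r L hs hok _ ih =>
    refine .node G r hs hok fun T hT => ?_
    obtain ⟨i, rfl⟩ := List.mem_iff_get.1 hT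
    exact ih i fun U hU => hL U (Set.mem_iUnion.2 ⟨i, hU⟩)


/-! ### Soundness -/

/-- Forcing is hereditary; forward confluence is what makes this true for `◇`. -/
theorem Forces.mono {M : Model At} (hM : M.IsBirelational) (hF : M.ForwardConfluent)
    {A : Formula At} {x y : M.World} (hxy : M.le x y) (h : Forces M x A) : Forces M y A := by
  induction A generalizing x y with
  | atom p => exact hM.hereditary x y hxy h
  | bot => exact h
  | top => trivial
  | and A B ihA ihB => exact ⟨ihA hxy h.1, ihB hxy h.2⟩
  | or A B ihA ihB => exact h.imp (ihA hxy) (ihB hxy)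
  | imp A B => exact fun w hw => h w (hM.le_trans _ _ _ hxy hw)
  | box A => exact fun w v hw => h w v (hM.le_trans _ _ _ hxy hw)
  | dia A ih =>
    obtain ⟨v, hv, hA⟩ := h
    obtain ⟨t, ht, hvt⟩ := hF y v ⟨x, hxy, hv⟩
    exact ⟨t, ht, ih hvt hA⟩

/-- `Refutes M S x`: the world `x` refutes the sequent `S`, that is, it forces the antecedent and
no member of the succedent, where `[T]` is forced iff no `R`-successor refutes `T`, and `⟨T⟩` is
forced iff no world above refutes `T`. -/
def Refutes (M : Model At) : Sequent At → M.World → Prop :=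
  fold fun s x => (∀ A ∈ s.ant, Forces M x A) ∧ (∀ A ∈ s.fml, ¬ Forces M x A) ∧
    (∀ φ ∈ s.box, ∃ y, M.R x y ∧ φ y) ∧ ∀ φ ∈ s.imp, ∃ y, M.le x y ∧ φ y

theorem refutes_iff {M : Model At} {S : Sequent At} {x : M.World} : Refutes M S x ↔
    (∀ A ∈ S.ant, Forces M x A) ∧ (∀ A ∈ S.fml, ¬ Forces M x A) ∧
      (∀ T ∈ S.box, ∃ y, M.R x y ∧ Refutes M T y) ∧ ∀ T ∈ S.imp, ∃ y, M.le x y ∧ Refutes M T y := by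
  unfold Refutes
  conv_lhs => rw [fold_eq]
  simp only [Finset.mem_image, forall_exists_index, and_imp, forall_apply_eq_imp_iff₂]

section refutes
variable {M : Model At} {S T : Sequent At} {A : Formula At} {x y : M.World}

theorem refutes_addL : Refutes M (S.addL A) x ↔ Forces M x A ∧ Refutes M S x := by
  simp only [refutes_iff (S := S.addL A), refutes_iff (S := S), ant_addL, fml_addL, box_addL,
    imp_addL, Finset.forall_mem_insert, and_assoc]

theorem refutes_addR : Refutes M (S.addR A) x ↔ ¬ Forces M x A ∧ Refutes M S x := by
  simp only [refutes_iff (S := S.addR A), refutes_iff (S := S), ant_addR, fml_addR, box_addR,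
    imp_addR, Finset.forall_mem_insert]
  tauto

theorem refutes_addBox :
    Refutes M (S.addBox T) x ↔ (∃ y, M.R x y ∧ Refutes M T y) ∧ Refutes M S x := by
  simp only [refutes_iff (S := S.addBox T), refutes_iff (S := S), ant_addBox, fml_addBox,
    box_addBox, imp_addBox, Finset.forall_mem_insert]
  tauto

theorem refutes_addImp :
    Refutes M (S.addImp T) x ↔ (∃ y, M.le x y ∧ Refutes M T y) ∧ Refutes M S x := by
  simp only [refutes_iff (S := S.addImp T), refutes_iff (S := S), ant_addImp, fml_addImp,
    box_addImp, imp_addImp, Finset.forall_mem_insert]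
  tauto

theorem refutes_addSetL {Γ : Finset (Formula At)} :
    Refutes M (S.addSetL Γ) x ↔ (∀ A ∈ Γ, Forces M x A) ∧ Refutes M S x := by
  simp only [refutes_iff (S := S.addSetL Γ), refutes_iff (S := S), ant_addSetL, fml_addSetL,
    box_addSetL, imp_addSetL, Finset.mem_union, or_imp, forall_and, and_assoc]

theorem refutes_empty : Refutes M empty x := by
  rw [refutes_iff]; simp

/-- Worlds above a world that refutes `Λ ⇒ Θ` refute `Λ ⇒ Θ*`, by forward confluence. -/
theorem Refutes.star (hM : M.IsBirelational) (hF : M.ForwardConfluent) (h : Refutes M S x)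
    (hxy : M.le x y) : Refutes M S.star y := by
  induction S using Sequent.ind generalizing x y with
  | h S ihb _ =>
    rw [refutes_iff] at h ⊢
    simp only [ant_star, fml_star, box_star, imp_star, Finset.forall_mem_image, Finset.notMem_empty,
      IsEmpty.forall_iff, implies_true, and_true, true_and]
    refine ⟨fun A hA => (h.1 A hA).mono hM hF hxy, fun T hT => ?_⟩
    obtain ⟨z, hz, hr⟩ := h.2.2.1 T hT
    obtain ⟨t, ht, hzt⟩ := hF y z ⟨x, hxy, hz⟩
    exact ⟨t, ht, ihb T hT hr hzt⟩

end refutes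

/-- A world that refutes `G{T}` leads to a world that refutes `T`, and anything else refuted
there may be put in the place of `T`. -/
theorem Refutes.exists_hole {M : Model At} {G : Context At} {T : Sequent At} {x : M.World}
    (h : Refutes M (G.fill T) x) :
    ∃ y, Refutes M T y ∧ ∀ U, Refutes M U y → Refutes M (G.fill U) x := by
  induction G generalizing x with
  | hole => exact ⟨x, h, fun U hU => hU⟩
  | imp S G ih =>
    obtain ⟨⟨z, hz, hr⟩, hS⟩ := refutes_addImp.1 h
    obtain ⟨y, hy, hU⟩ := ih hr
    exact ⟨y, hy, fun U h => refutes_addImp.2 ⟨⟨z, hz, hU U h⟩, hS⟩⟩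
  | box S G ih =>
    obtain ⟨⟨z, hz, hr⟩, hS⟩ := refutes_addBox.1 h
    obtain ⟨y, hy, hU⟩ := ih hr
    exact ⟨y, hy, fun U h => refutes_addBox.2 ⟨⟨z, hz, hU U h⟩, hS⟩⟩

theorem IsAxiom.not_refutes {S : Sequent At} (h : IsAxiom S) (M : Model At) (x : M.World) :
    ¬ Refutes M S x := by
  intro hr
  cases h with
  | botL G S =>
    obtain ⟨y, hy, -⟩ := hr.exists_hole
    exact (refutes_addL.1 hy).1
  | topR G S =>
    obtain ⟨y, hy, -⟩ := hr.exists_hole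
    exact (refutes_addR.1 hy).1 trivial
  | id G S A =>
    obtain ⟨y, hy, -⟩ := hr.exists_hole
    exact (refutes_addR.1 hy).1 (refutes_addL.1 (refutes_addR.1 hy).2).1

/-- A world that refutes the conclusion of a rule instance refutes one of its premises. -/
theorem Rule.exists_refutes {M : Model At} (hM : M.IsBirelational) (hF : M.ForwardConfluent)
    {r : Rule At} (hs : r.Side) {x : M.World} (h : Refutes M r.concl x) :
    ∃ T ∈ r.prems, Refutes M T x := by
  cases r <;> simp only [Rule.prems, Rule.concl, Rule.Side, List.mem_cons, List.not_mem_nil,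
    or_false, exists_eq_or_imp, exists_eq_left] at h hs ⊢
  case andL S A B =>
    obtain ⟨hA, hB⟩ := (refutes_addL.1 h).1
    exact refutes_addL.2 ⟨hA, refutes_addL.2 ⟨hB, h⟩⟩
  case andR S A B =>
    have h' := (refutes_addR.1 h).1
    rw [refutes_addR, refutes_addR (A := B)]
    by_cases hA : Forces M x A
    · exact .inr ⟨fun hB => h' ⟨hA, hB⟩, h⟩
    · exact .inl ⟨hA, h⟩
  case orL S A B =>
    rw [refutes_addL, refutes_addL (A := B)]
    exact (refutes_addL.1 h).1.imp (⟨·, h⟩) (⟨·, h⟩)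
  case orR S A B =>
    have h' := (refutes_addR.1 h).1
    exact refutes_addR.2 ⟨fun hB => h' (.inr hB), refutes_addR.2 ⟨fun hA => h' (.inl hA), h⟩⟩
  case impL S A B =>
    have h' := (refutes_addL.1 h).1
    rw [refutes_addL (A := B), refutes_addR]
    by_cases hA : Forces M x A
    · exact .inr ⟨h' x (hM.le_refl x) hA, h⟩
    · exact .inl ⟨hA, h⟩
  case impR₁ S A B =>
    exact refutes_addR.2 ⟨fun hB => (refutes_addR.1 h).1 fun y hy _ => hB.mono hM hF hy, h⟩
  case impR₂ S A B =>
    have h' := (refutes_addR.1 h).1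
    simp only [Forces, not_forall] at h'
    obtain ⟨y, hy, hA, hB⟩ := h'
    exact refutes_addImp.2
      ⟨⟨y, hy, refutes_addR.2 ⟨hB, refutes_addL.2 ⟨hA, refutes_empty⟩⟩⟩, h⟩
  case boxL S A T =>
    obtain ⟨⟨y, hy, hT⟩, hS⟩ := refutes_addBox.1 h
    exact refutes_addBox.2
      ⟨⟨y, hy, refutes_addL.2 ⟨(refutes_addL.1 hS).1 x y (hM.le_refl x) hy, hT⟩⟩, hS⟩
  case boxR S A =>
    have h' := (refutes_addR.1 h).1
    simp only [Forces, not_forall] at h'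
    obtain ⟨y, z, hy, hz, hA⟩ := h'
    exact refutes_addImp.2 ⟨⟨y, hy, refutes_addBox.2
      ⟨⟨z, hz, refutes_addR.2 ⟨hA, refutes_empty⟩⟩, refutes_empty⟩⟩, h⟩
  case diaL S A =>
    obtain ⟨y, hy, hA⟩ := (refutes_addL.1 h).1
    exact refutes_addBox.2 ⟨⟨y, hy, refutes_addL.2 ⟨hA, refutes_empty⟩⟩, h⟩
  case diaR S A T =>
    obtain ⟨⟨y, hy, hT⟩, hS⟩ := refutes_addBox.1 h
    exact refutes_addBox.2
      ⟨⟨y, hy, refutes_addR.2 ⟨fun hA => (refutes_addR.1 hS).1 ⟨y, hy, hA⟩, hT⟩⟩, hS⟩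
  case trans S Γ T =>
    obtain ⟨⟨y, hy, hT⟩, hS⟩ := refutes_addImp.1 h
    exact refutes_addImp.2 ⟨⟨y, hy, refutes_addSetL.2
      ⟨fun A hA => ((refutes_addSetL.1 hS).1 A hA).mono hM hF hy, hT⟩⟩, hS⟩
  case inter S T U =>
    obtain ⟨⟨z, hz, hU⟩, h'⟩ := refutes_addBox.1 h
    obtain ⟨⟨y, hy, hT⟩, hS⟩ := refutes_addImp.1 h'
    obtain ⟨t, ht, hzt⟩ := hF y z ⟨x, hy, hz⟩
    exact refutes_addBox.2 ⟨⟨z, hz, hU⟩, refutes_addImp.2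
      ⟨⟨y, hy, refutes_addBox.2 ⟨⟨t, ht, hU.star hM hF hzt⟩, hT⟩⟩, hS⟩⟩

/-- A world that refutes the root of a derivation refutes one of its leaves. -/
theorem CCDerivation.exists_refutes {M : Model At} (hM : M.IsBirelational)
    (hF : M.ForwardConfluent) {S : Sequent At} {L : Set (Sequent At)} (d : CCDerivation S L)
    {x : M.World} (h : Refutes M S x) : ∃ T ∈ L, Refutes M T x := by
  induction d with
  | leaf S => exact ⟨S, rfl, h⟩
  | node G r L hs _ _ ih =>
    obtain ⟨y, hy, hU⟩ := h.exists_hole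
    obtain ⟨T, hT, hTy⟩ := Rule.exists_refutes hM hF hs hy
    obtain ⟨i, rfl⟩ := List.mem_iff_get.1 hT
    obtain ⟨U, hUL, hr⟩ := ih i (hU _ hTy)
    exact ⟨U, Set.mem_iUnion.2 ⟨i, hUL⟩, hr⟩

/-- Soundness of the calculus. -/
theorem valid_of_provable {A : Formula At} (h : Provable (goal A)) : Valid A := by
  intro M hM hF w
  by_contra hA
  obtain ⟨L, d, hL⟩ := h
  obtain ⟨T, hT, hr⟩ := d.exists_refutes hM hF (refutes_addR.2 ⟨hA, refutes_empty⟩)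
  exact (hL T hT).not_refutes M w hr

/-! ### The countermodel of a global-saturated sequent -/

theorem seqModel_isBirelational (S : Sequent At) : (seqModel S).IsBirelational where
  nonempty := ⟨seqModelRoot S⟩
  le_refl x := StructIncl.refl x.1
  le_trans _ _ _ h h' := StructIncl.trans h h'
  hereditary _ _ h _ hp := ((structIncl_iff _ _).1 h).1 hp

theorem seqModel_forwardConfluent (S : Sequent At) : (seqModel S).ForwardConfluent := by
  rintro ⟨T, hT⟩ ⟨U, hU⟩ ⟨⟨Z, hZ⟩, hle, hR⟩
  obtain ⟨V, hV, h⟩ := ((structIncl_iff _ _).1 hle).2 U hR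
  exact ⟨⟨V, hT.of_box hV⟩, hV, h⟩

theorem Sequent.GlobalSaturated.condR1 {S T : Sequent At} (hS : S.GlobalSaturated)
    (hT : T.InPlus S) : T.CondR1 := by
  rw [← condR1_sharp_iff]
  rcases hS.2 T hT with h | ⟨U, _, hU, _, -, he⟩
  · exact h.1.1.2
  · rw [← he]; exact hU.1.1.2

/-- Every component of a global-saturated sequent is `≃`-equivalent to an R3-saturated one. -/
theorem Sequent.GlobalSaturated.exists_equiv {S T : Sequent At} (hS : S.GlobalSaturated)
    (hT : T.InPlus S) : ∃ U : Sequent At, U.InPlus S ∧ U.sharp = T.sharp ∧ U.CondR2 ∧ U.CondR3 := by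
  rcases hS.2 T hT with h | ⟨U, hUS, hU, _, -, he⟩
  · exact ⟨T, hT, rfl, h.1.2, h.2⟩
  · exact ⟨U, hUS, he, hU.1.2, hU.2⟩

/-- Truth lemma: in the model of a global-saturated sequent every component forces its antecedent
and no formula of its succedent. The right rules for `⊃` and `□` are handled at an R3-saturated
component equivalent to the given one. -/
theorem Sequent.GlobalSaturated.forces {S : Sequent At} (hS : S.GlobalSaturated)
    (A : Formula At) (x : (seqModel S).World) :
    (A ∈ x.1.ant → Forces (seqModel S) x A) ∧ (A ∈ x.1.fml → ¬ Forces (seqModel S) x A) := by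
  have hM := seqModel_isBirelational S
  have hF := seqModel_forwardConfluent S
  have ant_mono : ∀ {x y : (seqModel S).World}, (seqModel S).le x y → x.1.ant ⊆ y.1.ant :=
    fun h => ((structIncl_iff _ _).1 h).1
  induction A generalizing x with
  | atom p => exact ⟨fun h => h, fun h h' => (hS.condR1 x.2).id p ⟨h', h⟩⟩
  | bot => exact ⟨fun h => (hS.condR1 x.2).botL h, fun _ h => h⟩
  | top => exact ⟨fun _ => trivial, fun h => ((hS.condR1 x.2).topR h).elim⟩
  | and A B ihA ihB =>
    refine ⟨fun h => ?_, fun h h' => ?_⟩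
    · have := (hS.condR1 x.2).andL A B h
      exact ⟨(ihA x).1 this.1, (ihB x).1 this.2⟩
    · rcases (hS.condR1 x.2).andR A B h with h | h
      exacts [(ihA x).2 h h'.1, (ihB x).2 h h'.2]
  | or A B ihA ihB =>
    refine ⟨fun h => ?_, fun h h' => ?_⟩
    · exact ((hS.condR1 x.2).orL A B h).imp (ihA x).1 (ihB x).1
    · have := (hS.condR1 x.2).orR A B h
      exact h'.elim ((ihA x).2 this.1) ((ihB x).2 this.2)
  | imp A B ihA ihB =>
    refine ⟨fun h y hxy hA => ?_, fun h h' => ?_⟩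
    · rcases (hS.condR1 y.2).impL A B (ant_mono hxy h) with h | h
      exacts [((ihA y).2 h hA).elim, (ihB y).1 h]
    · obtain ⟨U, hUS, he, h2, h3⟩ := hS.exists_equiv x.2
      have hxU : StructIncl x.1 U := structIncl_of_sharp_eq he.symm
      rw [← fml_eq_of_sharp_eq he] at h
      rcases h3.impR A B h with ⟨hA, hB⟩ | ⟨T, hT, hA, hB⟩
      · exact (ihB ⟨U, hUS⟩).2 hB (h' ⟨U, hUS⟩ hxU ((ihA ⟨U, hUS⟩).1 hA))
      · have hT' := hUS.of_imp hT
        exact (ihB ⟨T, hT'⟩).2 hB (h' ⟨T, hT'⟩ (hxU.trans (condR2_iff.1 h2 T hT))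
          ((ihA ⟨T, hT'⟩).1 hA))
  | box A ih =>
    refine ⟨fun h y z hxy hyz => ?_, fun h h' => ?_⟩
    · exact (ih z).1 ((hS.condR1 y.2).boxL A (ant_mono hxy h) z.1 hyz)
    · obtain ⟨U, hUS, he, h2, h3⟩ := hS.exists_equiv x.2
      have hxU : StructIncl x.1 U := structIncl_of_sharp_eq he.symm
      rw [← fml_eq_of_sharp_eq he] at h
      rcases h3.boxR A h with ⟨V, hV, hA⟩ | ⟨T, hT, V, hV, hA⟩
      · have hV' := hUS.of_box hV
        exact (ih ⟨V, hV'⟩).2 hA (h' ⟨U, hUS⟩ ⟨V, hV'⟩ hxU hV)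
      · have hT' := hUS.of_imp hT
        have hV' := hT'.of_box hV
        exact (ih ⟨V, hV'⟩).2 hA
          (h' ⟨T, hT'⟩ ⟨V, hV'⟩ (hxU.trans (condR2_iff.1 h2 T hT)) hV)
  | dia A ih =>
    refine ⟨fun h => ?_, fun h => ?_⟩
    · obtain ⟨T, hT, hA⟩ := (hS.condR1 x.2).diaL A h
      exact ⟨⟨T, x.2.of_box hT⟩, hT, (ih _).1 hA⟩
    · rintro ⟨y, hy, hA⟩
      exact (ih y).2 ((hS.condR1 x.2).diaR A h y.1 hy) hA

/-- Rules are cumulative: premises contain the formulas of the conclusion. -/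
theorem Rule.fml_concl_subset {r : Rule At} {T : Sequent At} (h : T ∈ r.prems) :
    r.concl.fml ⊆ T.fml := by
  cases r <;> simp only [Rule.prems, List.mem_cons, List.not_mem_nil, or_false] at h <;>
    rcases h with rfl | rfl <;> intro F hF <;> simp [Rule.concl] at hF ⊢ <;> tauto

theorem CCDerivation.fml_subset {S : Sequent At} {L : Set (Sequent At)} (d : CCDerivation S L)
    {T : Sequent At} (hT : T ∈ L) : S.fml ⊆ T.fml := by
  induction d with
  | leaf S => rw [Set.mem_singleton_iff.1 hT]
  | node G r L _ _ _ ih =>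
    obtain ⟨i, hi⟩ := Set.mem_iUnion.1 hT
    refine subset_trans ?_ (ih i hi)
    cases G with
    | hole => exact Rule.fml_concl_subset (List.get_mem _ _)
    | imp U G => simp [Context.fill]
    | box U G => simp [Context.fill]

/-- A global-saturated leaf of a derivation of `⇒ A` determines a countermodel of `A`. -/
theorem not_forces_of_globalSaturated {A : Formula At} {L : Set (Sequent At)}
    (d : CCDerivation (goal A) L) {S : Sequent At} (hS : S ∈ L) (h : S.GlobalSaturated) :
    ¬ Forces (seqModel S) (seqModelRoot S) A :=
  (h.forces A (seqModelRoot S)).2 (d.fml_subset hS (by simp [goal]))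


/-! ### The finite space of sequents over the subformulas of a formula -/

namespace Formula

/-- The modal degree. -/
def deg : Formula At → ℕ
  | .atom _ | .bot | .top => 0
  | .and A B | .or A B | .imp A B => max A.deg B.deg
  | .box A | .dia A => A.deg + 1

/-- The set of subformulas. -/
noncomputable def sub : Formula At → Finset (Formula At)
  | .atom p => {.atom p}
  | .bot => {.bot}
  | .top => {.top}
  | .and A B => insert (.and A B) (A.sub ∪ B.sub)
  | .or A B => insert (.or A B) (A.sub ∪ B.sub)
  | .imp A B => insert (.imp A B) (A.sub ∪ B.sub)
  | .box A => insert (.box A) A.sub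
  | .dia A => insert (.dia A) A.sub

theorem mem_sub_self (A : Formula At) : A ∈ A.sub := by
  cases A <;> simp [sub]

theorem sub_subset {A F : Formula At} (h : A ∈ F.sub) : A.sub ⊆ F.sub := by
  induction F with
  | atom p | bot | top => rw [sub, Finset.mem_singleton] at h; rw [h]
  | and B C ihB ihC | or B C ihB ihC | imp B C ihB ihC =>
    rw [sub, Finset.mem_insert, Finset.mem_union] at h
    rcases h with rfl | h | h
    · exact subset_rfl
    · exact (ihB h).trans (Finset.subset_union_left.trans (Finset.subset_insert _ _))
    · exact (ihC h).trans (Finset.subset_union_right.trans (Finset.subset_insert _ _))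
  | box B ihB | dia B ihB =>
    rw [sub, Finset.mem_insert] at h
    rcases h with rfl | h
    · exact subset_rfl
    · exact (ihB h).trans (Finset.subset_insert _ _)

end Formula

/-- The subformulas of `F` of modal degree at most `m`. -/
noncomputable def Lab (F : Formula At) (m : ℕ) : Finset (Formula At) :=
  F.sub.filter fun A => A.deg ≤ m

section lab
variable {F A B : Formula At} {m n : ℕ}

theorem mem_lab : A ∈ Lab F m ↔ A ∈ F.sub ∧ A.deg ≤ m := by simp [Lab]

theorem lab_mono (h : m ≤ n) : Lab F m ⊆ Lab F n := fun _ hA =>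
  mem_lab.2 ⟨(mem_lab.1 hA).1, (mem_lab.1 hA).2.trans h⟩

theorem lab_of_sub (h : A ∈ Lab F m) (hB : B ∈ A.sub) (hd : B.deg ≤ n) :
    B ∈ Lab F n :=
  mem_lab.2 ⟨Formula.sub_subset (mem_lab.1 h).1 hB, hd⟩

theorem lab_and (h : .and A B ∈ Lab F m) : A ∈ Lab F m ∧ B ∈ Lab F m := by
  have hd := (mem_lab.1 h).2
  rw [Formula.deg, max_le_iff] at hd
  exact ⟨lab_of_sub h (by simp [Formula.sub, Formula.mem_sub_self]) hd.1,
    lab_of_sub h (by simp [Formula.sub, Formula.mem_sub_self]) hd.2⟩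

theorem lab_or (h : .or A B ∈ Lab F m) : A ∈ Lab F m ∧ B ∈ Lab F m := by
  have hd := (mem_lab.1 h).2
  rw [Formula.deg, max_le_iff] at hd
  exact ⟨lab_of_sub h (by simp [Formula.sub, Formula.mem_sub_self]) hd.1,
    lab_of_sub h (by simp [Formula.sub, Formula.mem_sub_self]) hd.2⟩

theorem lab_imp (h : .imp A B ∈ Lab F m) : A ∈ Lab F m ∧ B ∈ Lab F m := by
  have hd := (mem_lab.1 h).2
  rw [Formula.deg, max_le_iff] at hd
  exact ⟨lab_of_sub h (by simp [Formula.sub, Formula.mem_sub_self]) hd.1,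
    lab_of_sub h (by simp [Formula.sub, Formula.mem_sub_self]) hd.2⟩

theorem lab_box (h : .box A ∈ Lab F m) : 1 ≤ m ∧ A ∈ Lab F (m - 1) := by
  have hd := (mem_lab.1 h).2
  rw [Formula.deg] at hd
  exact ⟨by omega, lab_of_sub h (by simp [Formula.sub, Formula.mem_sub_self]) (by omega)⟩

theorem lab_dia (h : .dia A ∈ Lab F m) : 1 ≤ m ∧ A ∈ Lab F (m - 1) := by
  have hd := (mem_lab.1 h).2
  rw [Formula.deg] at hd
  exact ⟨by omega, lab_of_sub h (by simp [Formula.sub, Formula.mem_sub_self]) (by omega)⟩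

end lab

/-- `Bdd F m S`: all formulas of `S` are subformulas of `F`, and their modal degree is at most `m`
outside modal blocks, at most `m - 1` inside one modal block, and so on. In particular at most `m`
modal blocks are nested, no matter how many implication blocks lie between them. -/
inductive Bdd (F : Formula At) : ℕ → Sequent At → Prop
  | intro {m : ℕ} {S : Sequent At} (ant : S.ant ⊆ Lab F m) (fml : S.fml ⊆ Lab F m)
      (pos : S.box.Nonempty → 1 ≤ m) (box : ∀ T ∈ S.box, Bdd F (m - 1) T)
      (imp : ∀ T ∈ S.imp, Bdd F m T) : Bdd F m S

section bdd
variable {F A : Formula At} {m n : ℕ} {S T : Sequent At}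

theorem Bdd.ant_subset (h : Bdd F m S) : S.ant ⊆ Lab F m := by cases h; assumption
theorem Bdd.fml_subset (h : Bdd F m S) : S.fml ⊆ Lab F m := by cases h; assumption
theorem Bdd.pos (h : Bdd F m S) (hT : T ∈ S.box) : 1 ≤ m := by
  cases h with | intro _ _ h _ _ => exact h ⟨T, hT⟩
theorem Bdd.of_box (h : Bdd F m S) (hT : T ∈ S.box) : Bdd F (m - 1) T := by
  cases h with | intro _ _ _ h _ => exact h T hT
theorem Bdd.of_imp (h : Bdd F m S) (hT : T ∈ S.imp) : Bdd F m T := by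
  cases h with | intro _ _ _ _ h => exact h T hT

theorem Bdd.mono (h : Bdd F m S) (hmn : m ≤ n) : Bdd F n S := by
  induction h generalizing n with
  | intro h1 h2 h3 h4 h5 ih4 ih5 =>
    exact ⟨h1.trans (lab_mono hmn), h2.trans (lab_mono hmn), fun h => (h3 h).trans hmn,
      fun T hT => ih4 T hT (by omega), fun T hT => ih5 T hT hmn⟩

theorem Bdd.addL (h : Bdd F m S) (hA : A ∈ Lab F m) : Bdd F m (S.addL A) :=
  ⟨by simpa using Finset.insert_subset hA h.ant_subset, by simpa using h.fml_subset,
    fun ⟨T, hT⟩ => h.pos (by simpa using hT), fun T hT => h.of_box (by simpa using hT),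
    fun T hT => h.of_imp (by simpa using hT)⟩

theorem Bdd.addR (h : Bdd F m S) (hA : A ∈ Lab F m) : Bdd F m (S.addR A) :=
  ⟨by simpa using h.ant_subset, by simpa using Finset.insert_subset hA h.fml_subset,
    fun ⟨T, hT⟩ => h.pos (by simpa using hT), fun T hT => h.of_box (by simpa using hT),
    fun T hT => h.of_imp (by simpa using hT)⟩

theorem Bdd.addSetL {Γ : Finset (Formula At)} (h : Bdd F m S) (hA : Γ ⊆ Lab F m) :
    Bdd F m (S.addSetL Γ) :=
  ⟨by simpa using Finset.union_subset hA h.ant_subset, by simpa using h.fml_subset,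
    fun ⟨T, hT⟩ => h.pos (by simpa using hT), fun T hT => h.of_box (by simpa using hT),
    fun T hT => h.of_imp (by simpa using hT)⟩

theorem Bdd.addBox (h : Bdd F m S) (hm : 1 ≤ m) (hT : Bdd F (m - 1) T) : Bdd F m (S.addBox T) :=
  ⟨by simpa using h.ant_subset, by simpa using h.fml_subset, fun _ => hm,
    by simpa using ⟨hT, fun T => h.of_box⟩, by simpa using fun T => h.of_imp⟩

theorem Bdd.addImp (h : Bdd F m S) (hT : Bdd F m T) : Bdd F m (S.addImp T) :=
  ⟨by simpa using h.ant_subset, by simpa using h.fml_subset,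
    fun ⟨T, hT⟩ => h.pos (T := T) (by simpa using hT), by simpa using fun T => h.of_box,
    by simpa using ⟨hT, fun T => h.of_imp⟩⟩

theorem Bdd.eraseBox (h : Bdd F m S) : Bdd F m (S.eraseBox T) :=
  ⟨by simpa using h.ant_subset, by simpa using h.fml_subset,
    fun ⟨T, hT⟩ => h.pos (T := T) (by simp at hT; exact hT.2),
    by simpa using fun T _ => h.of_box, by simpa using fun T => h.of_imp⟩

theorem Bdd.eraseImp (h : Bdd F m S) : Bdd F m (S.eraseImp T) :=
  ⟨by simpa using h.ant_subset, by simpa using h.fml_subset,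
    fun ⟨T, hT⟩ => h.pos (T := T) (by simpa using hT),
    by simpa using fun T => h.of_box, by simpa using fun T _ => h.of_imp⟩

theorem bdd_empty : Bdd F m empty :=
  ⟨by simp, by simp, by simp, by simp, by simp⟩

theorem Bdd.sharp (h : Bdd F m S) : Bdd F m S.sharp := by
  induction h with
  | intro h1 h2 h3 h4 h5 ih4 ih5 =>
    exact ⟨by simpa using h1, by simpa using h2, by simpa using h3, by simpa using ih4, by simp⟩

theorem Bdd.star (h : Bdd F m S) : Bdd F m S.star := by
  induction h with
  | intro h1 h2 h3 h4 h5 ih4 ih5 =>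
    exact ⟨by simpa using h1, by simp, by simpa using h3, by simpa using ih4, by simp⟩

/-- `S` contains no implication block at any depth. -/
def Sequent.ImpFree (S : Sequent At) : Prop := S.sharp = S

theorem Sequent.impFree_iff : S.ImpFree ↔ S.imp = ∅ ∧ ∀ T ∈ S.box, T.ImpFree := by
  unfold ImpFree
  constructor
  · intro h
    refine ⟨by rw [← h, imp_sharp], fun T hT => ?_⟩
    rw [← h, box_sharp, Finset.mem_image] at hT
    obtain ⟨U, _, rfl⟩ := hT
    exact sharp_sharp U
  · rintro ⟨h1, h2⟩
    apply ext_parts <;> simp [h1]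
    conv_rhs => rw [← Finset.image_id (s := S.box)]
    exact Finset.image_congr h2

theorem Sequent.impFree_sharp (S : Sequent At) : S.sharp.ImpFree := sharp_sharp S

theorem Sequent.impFree_star (S : Sequent At) : S.star.ImpFree := by
  induction S using Sequent.ind with
  | h S ihb _ => exact impFree_iff.2 ⟨by simp, by simpa using ihb⟩

theorem Sequent.impFree_empty : (empty : Sequent At).ImpFree := impFree_iff.2 (by simp)

theorem Sequent.ImpFree.of_inPlus (hS : S.ImpFree) (h : T.InPlus S) : T.ImpFree := by
  induction S using Sequent.ind with
  | h S ihb ihi =>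
    rcases inPlus_iff.1 h with rfl | ⟨U, hU, -⟩ | ⟨U, hU, h⟩
    · exact hS
    · rw [(impFree_iff.1 hS).1] at hU; simp at hU
    · exact ihb U hU ((impFree_iff.1 hS).2 U hU) h

theorem Sequent.ImpFree.addL (h : S.ImpFree) : (S.addL A).ImpFree := by
  rw [impFree_iff] at h ⊢; simpa using h

theorem Sequent.ImpFree.addR (h : S.ImpFree) : (S.addR A).ImpFree := by
  rw [impFree_iff] at h ⊢; simpa using h

theorem Sequent.ImpFree.addSetL {Γ : Finset (Formula At)} (h : S.ImpFree) :
    (S.addSetL Γ).ImpFree := by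
  rw [impFree_iff] at h ⊢; simpa using h

theorem Sequent.ImpFree.addBox (h : S.ImpFree) (hT : T.ImpFree) : (S.addBox T).ImpFree := by
  rw [impFree_iff] at h ⊢; simpa using ⟨h.1, hT, h.2⟩

theorem Sequent.ImpFree.eraseBox (h : S.ImpFree) : (S.eraseBox T).ImpFree := by
  rw [impFree_iff] at h ⊢; simpa using ⟨h.1, fun U _ => h.2 U⟩

theorem finite_impFree_bdd (F : Formula At) (m : ℕ) :
    {S : Sequent At | Bdd F m S ∧ S.ImpFree}.Finite := by
  -- a sequent without implication blocks is determined by its formulas and its modal blocks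
  have key : ∀ (m : ℕ) (X : Set (Sequent At)), X.Finite →
      (∀ S : Sequent At, Bdd F m S ∧ S.ImpFree → ∀ T ∈ S.box, T ∈ X) →
      {S : Sequent At | Bdd F m S ∧ S.ImpFree}.Finite := by
    intro m X hX h
    refine (((Lab F m).powerset ×ˢ (Lab F m).powerset ×ˢ hX.toFinset.powerset).image
      fun p => mk p.1 p.2.1 p.2.2 ∅).finite_toSet.subset fun S hS => ?_
    simp only [Finset.coe_image, Set.mem_image, Finset.mem_coe, Finset.mem_product,
      Finset.mem_powerset]
    refine ⟨(S.ant, S.fml, S.box), ⟨hS.1.ant_subset, hS.1.fml_subset, ?_⟩, ?_⟩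
    · exact fun T hT => hX.mem_toFinset.2 (h S hS T hT)
    · apply ext_parts <;> simp [(impFree_iff.1 hS.2).1]
  induction m with
  | zero => exact key 0 ∅ Set.finite_empty fun S hS T hT => absurd (hS.1.pos hT) (by simp)
  | succ m ih =>
    exact key _ _ ih fun S hS T hT => ⟨hS.1.of_box hT, (impFree_iff.1 hS.2).2 T hT⟩

/-- The sequents without implication blocks that are bounded by the modal degree of `F`. -/
noncomputable def Uni (F : Formula At) : Finset (Sequent At) :=
  (finite_impFree_bdd F F.deg).toFinset

theorem mem_uni : S ∈ Uni F ↔ Bdd F F.deg S ∧ S.ImpFree := by simp [Uni]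

theorem Bdd.sharp_mem_uni (h : Bdd F m S) (hm : m ≤ F.deg) : S.sharp ∈ Uni F :=
  mem_uni.2 ⟨(h.mono hm).sharp, S.impFree_sharp⟩

/-- A component of a bounded sequent sits in a fresh context, and may be replaced there by any
sequent within the same bound. -/
theorem Bdd.exists_context (h : Bdd F m S) (hT : T.InPlus S) :
    ∃ (G : Context At) (n : ℕ), G.fill T = S ∧ G.Fresh T ∧ n ≤ m ∧ Bdd F n T ∧
      (∀ U, Bdd F n U → Bdd F m (G.fill U)) ∧
      (S.ImpFree → n + G.len ≤ m ∧ ∀ U : Sequent At, U.ImpFree → (G.fill U).ImpFree) := by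
  induction S using Sequent.ind generalizing m with
  | h S ihb ihi =>
    rcases inPlus_iff.1 hT with rfl | ⟨V, hV, hT⟩ | ⟨V, hV, hT⟩
    · exact ⟨.hole, m, rfl, trivial, le_rfl, h, fun U hU => hU,
        fun _ => ⟨by simp [Context.len], fun U hU => hU⟩⟩
    · obtain ⟨G, n, hG, hf, hn, hb, hU, -⟩ := ihi V hV (h.of_imp hV) hT
      refine ⟨.imp (S.eraseImp V) G, n, ?_, ⟨?_, hf⟩, hn, hb, fun U hU' => ?_, fun hS => ?_⟩
      · rw [Context.fill, hG, eraseImp_addImp hV]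
      · simp [hG]
      · exact h.eraseImp.addImp (hU U hU')
      · rw [(impFree_iff.1 hS).1] at hV; simp at hV
    · obtain ⟨G, n, hG, hf, hn, hb, hU, hi⟩ := ihb V hV (h.of_box hV) hT
      have := h.pos hV
      refine ⟨.box (S.eraseBox V) G, n, ?_, ⟨?_, hf⟩, by omega, hb, fun U hU' => ?_, fun hS => ?_⟩
      · rw [Context.fill, hG, eraseBox_addBox hV]
      · simp [hG]
      · exact h.eraseBox.addBox this (hU U hU')
      · obtain ⟨h1, h2⟩ := hi ((impFree_iff.1 hS).2 V hV)
        exact ⟨by simp only [Context.len]; omega, fun U hU => hS.eraseBox.addBox (h2 U hU)⟩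

end bdd

/-! ### Growth of sequents and the weight that bounds it -/

/-- `Le S T`: `T` arises from `S` by adding formulas and blocks at any depth (and identifying
blocks that have become equal). -/
def Sequent.Le : Sequent At → Sequent At → Prop :=
  fold fun s T => s.ant ⊆ T.ant ∧ s.fml ⊆ T.fml ∧
    (∀ φ ∈ s.box, ∃ T' ∈ T.box, φ T') ∧ ∀ φ ∈ s.imp, ∃ T' ∈ T.imp, φ T'

theorem Sequent.le_iff {S T : Sequent At} : S.Le T ↔ S.ant ⊆ T.ant ∧ S.fml ⊆ T.fml ∧
    (∀ S' ∈ S.box, ∃ T' ∈ T.box, S'.Le T') ∧ ∀ S' ∈ S.imp, ∃ T' ∈ T.imp, S'.Le T' := by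
  unfold Le
  conv_lhs => rw [fold_eq]
  simp only [Finset.mem_image, forall_exists_index, and_imp, forall_apply_eq_imp_iff₂]

namespace Sequent.Le
variable {S T U : Sequent At}

theorem refl (S : Sequent At) : S.Le S := by
  induction S using Sequent.ind with
  | h S ihb ihi => exact le_iff.2 ⟨subset_rfl, subset_rfl, fun T hT => ⟨T, hT, ihb T hT⟩,
      fun T hT => ⟨T, hT, ihi T hT⟩⟩

theorem trans (h₁ : S.Le T) (h₂ : T.Le U) : S.Le U := by
  induction S using Sequent.ind generalizing T U with
  | h S ihb ihi =>
    rw [le_iff] at h₁ h₂ ⊢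
    refine ⟨h₁.1.trans h₂.1, h₁.2.1.trans h₂.2.1, fun S' hS' => ?_, fun S' hS' => ?_⟩
    · obtain ⟨T', hT', h⟩ := h₁.2.2.1 S' hS'
      obtain ⟨U', hU', h'⟩ := h₂.2.2.1 T' hT'
      exact ⟨U', hU', ihb S' hS' h h'⟩
    · obtain ⟨T', hT', h⟩ := h₁.2.2.2 S' hS'
      obtain ⟨U', hU', h'⟩ := h₂.2.2.2 T' hT'
      exact ⟨U', hU', ihi S' hS' h h'⟩

theorem of_subset (h1 : S.ant ⊆ T.ant) (h2 : S.fml ⊆ T.fml) (h3 : S.box ⊆ T.box)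
    (h4 : S.imp ⊆ T.imp) : S.Le T :=
  le_iff.2 ⟨h1, h2, fun U hU => ⟨U, h3 hU, refl U⟩, fun U hU => ⟨U, h4 hU, refl U⟩⟩

theorem addL (S : Sequent At) (A : Formula At) : S.Le (S.addL A) := by
  apply of_subset <;> simp

theorem addR (S : Sequent At) (A : Formula At) : S.Le (S.addR A) := by
  apply of_subset <;> simp

theorem addSetL (S : Sequent At) (Γ : Finset (Formula At)) : S.Le (S.addSetL Γ) := by
  apply of_subset <;> simp

theorem addBox (S T : Sequent At) : S.Le (S.addBox T) := by
  apply of_subset <;> simp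

theorem addImp (S T : Sequent At) : S.Le (S.addImp T) := by
  apply of_subset <;> simp

theorem addBox_congr (S : Sequent At) (h : T.Le U) : (S.addBox T).Le (S.addBox U) := by
  rw [le_iff]
  simp only [ant_addBox, fml_addBox, box_addBox, imp_addBox, Finset.forall_mem_insert,
    Finset.exists_mem_insert]
  exact ⟨subset_rfl, subset_rfl, ⟨.inl h, fun V hV => .inr ⟨V, hV, refl V⟩⟩,
    fun V hV => ⟨V, hV, refl V⟩⟩

theorem addImp_congr (S : Sequent At) (h : T.Le U) : (S.addImp T).Le (S.addImp U) := by
  rw [le_iff]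
  simp only [ant_addImp, fml_addImp, box_addImp, imp_addImp, Finset.forall_mem_insert,
    Finset.exists_mem_insert]
  exact ⟨subset_rfl, subset_rfl, fun V hV => ⟨V, hV, refl V⟩,
    .inl h, fun V hV => .inr ⟨V, hV, refl V⟩⟩

theorem fill (G : Context At) (h : T.Le U) : (G.fill T).Le (G.fill U) := by
  induction G with
  | hole => exact h
  | imp S G ih => exact addImp_congr S ih
  | box S G ih => exact addBox_congr S ih

theorem ant_subset (h : S.Le T) : S.ant ⊆ T.ant := (le_iff.1 h).1
theorem fml_subset (h : S.Le T) : S.fml ⊆ T.fml := (le_iff.1 h).2.1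

theorem structIncl (h : S.Le T) : StructIncl S T := by
  induction S using Sequent.ind generalizing T with
  | h S ihb _ =>
    rw [le_iff] at h
    refine (structIncl_iff _ _).2 ⟨h.1, fun U hU => ?_⟩
    obtain ⟨V, hV, hUV⟩ := h.2.2.1 U hU
    exact ⟨V, hV, ihb U hU hUV⟩

theorem exists_box {P : Sequent At → Prop} (h : S.Le T)
    (hP : ∀ U V : Sequent At, U.Le V → P U → P V)
    (hS : ∃ U ∈ S.box, P U) : ∃ U ∈ T.box, P U := by
  obtain ⟨U, hU, hPU⟩ := hS
  obtain ⟨V, hV, hUV⟩ := (le_iff.1 h).2.2.1 U hU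
  exact ⟨V, hV, hP U V hUV hPU⟩

theorem exists_imp {P : Sequent At → Prop} (h : S.Le T)
    (hP : ∀ U V : Sequent At, U.Le V → P U → P V)
    (hS : ∃ U ∈ S.imp, P U) : ∃ U ∈ T.imp, P U := by
  obtain ⟨U, hU, hPU⟩ := hS
  obtain ⟨V, hV, hUV⟩ := (le_iff.1 h).2.2.2 U hU
  exact ⟨V, hV, hP U V hUV hPU⟩

end Sequent.Le

/-- The saturation condition of the right rule for the principal connective of a formula; only
`⊃` and `□` matter. -/
def Sequent.SatR (S : Sequent At) : Formula At → Prop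
  | .imp A B => S.SatImpR A B
  | .box A => S.SatBoxR A
  | _ => True

theorem Sequent.SatR.mono {S T : Sequent At} {A : Formula At} (h : S.SatR A) (hST : S.Le T) :
    T.SatR A := by
  cases A with
  | imp A B =>
    refine h.imp (fun h => ⟨hST.ant_subset h.1, hST.fml_subset h.2⟩) (hST.exists_imp ?_)
    exact fun U V hUV h => ⟨hUV.ant_subset h.1, hUV.fml_subset h.2⟩
  | box A =>
    have : ∀ U V : Sequent At, U.Le V → A ∈ U.fml → A ∈ V.fml := fun U V hUV h => hUV.fml_subset h
    exact h.imp (hST.exists_box this) (hST.exists_imp fun U V hUV => hUV.exists_box this)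
  | _ => trivial

theorem Sequent.condR3_iff {S : Sequent At} : S.CondR3 ↔ ∀ A ∈ S.fml, S.SatR A := by
  constructor
  · rintro ⟨h1, h2⟩ A hA
    cases A with
    | imp A B => exact h1 A B hA
    | box A => exact h2 A hA
    | _ => trivial
  · exact fun h => ⟨fun A B hA => h _ hA, fun A hA => h _ hA⟩

/-- Properties of a component that search steps may bring about and never destroy. -/
inductive Req (At : Type u) : Type u
  /-- `A` is in the antecedent. -/
  | ant (A : Formula At)
  /-- `A` is in the succedent. -/
  | fml (A : Formula At)
  /-- Some modal block has `A` in its antecedent. -/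
  | dia (A : Formula At)
  /-- Some modal block structurally includes `V`. -/
  | inter (V : Sequent At)
  /-- The right rule for `A` is not needed. -/
  | right (A : Formula At)

/-- The sequent has the given property. -/
def Req.Met (S : Sequent At) : Req At → Prop
  | .ant A => A ∈ S.ant
  | .fml A => A ∈ S.fml
  | .dia A => ∃ U ∈ S.box, A ∈ U.ant
  | .inter V => ∃ U ∈ S.box, StructIncl V U
  | .right A => S.SatR A

theorem Req.Met.mono {S T : Sequent At} {r : Req At} (h : r.Met S) (hST : S.Le T) : r.Met T := by
  cases r with
  | ant A => exact hST.ant_subset h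
  | fml A => exact hST.fml_subset h
  | dia A => exact hST.exists_box (fun U V hUV h => hUV.ant_subset h) h
  | inter V => exact hST.exists_box (fun U V hUV h => h.trans hUV.structIncl) h
  | right A => exact SatR.mono h hST

open Classical in
/-- The properties that matter in the search for `F`. -/
noncomputable def reqs (F : Formula At) : Finset (Req At) :=
  (Lab F F.deg).image .ant ∪ (Lab F F.deg).image .fml ∪ (Lab F F.deg).image .dia ∪
    (Uni F).image .inter ∪ (Lab F F.deg).image .right

section reqs
variable {F A : Formula At}

theorem ant_mem_reqs (h : A ∈ Lab F F.deg) : .ant A ∈ reqs F := by simp [reqs, h]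
theorem fml_mem_reqs (h : A ∈ Lab F F.deg) : .fml A ∈ reqs F := by simp [reqs, h]
theorem dia_mem_reqs (h : A ∈ Lab F F.deg) : .dia A ∈ reqs F := by simp [reqs, h]
theorem inter_mem_reqs {V : Sequent At} (h : V ∈ Uni F) : .inter V ∈ reqs F := by simp [reqs, h]
theorem right_mem_reqs (h : A ∈ Lab F F.deg) : .right A ∈ reqs F := by simp [reqs, h]

end reqs

open Classical in
/-- The number of properties that `S` lacks. -/
noncomputable def lacking (F : Formula At) (S : Sequent At) : ℕ :=
  ((reqs F).filter fun r => ¬ r.Met S).card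

theorem lacking_mono {F : Formula At} {S T : Sequent At} (h : S.Le T) :
    lacking F T ≤ lacking F S := by
  classical
  exact Finset.card_le_card
    (Finset.monotone_filter_right _ fun r _ hr hS => hr (hS.mono h))

theorem lacking_lt {F : Formula At} {S T : Sequent At} (h : S.Le T) {r : Req At} (hr : r ∈ reqs F)
    (hS : ¬ r.Met S) (hT : r.Met T) : lacking F T < lacking F S := by
  classical
  refine Finset.card_lt_card ((Finset.ssubset_iff_of_subset ?_).2 ⟨r, ?_, ?_⟩)
  · exact Finset.monotone_filter_right _ fun r _ hr hS => hr (hS.mono h)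
  · exact Finset.mem_filter.2 ⟨hr, hS⟩
  · exact fun h => (Finset.mem_filter.1 h).2 hT

/-- The weight of the components of `S` at depth less than `k`. A property that a component lacks
weighs more than any block without implication blocks that may be added to provide it. -/
noncomputable def weight (F : Formula At) : ℕ → Sequent At → ℕ
  | 0, _ => 0
  | k + 1, S => lacking F S * ((Uni F).sup (weight F k) + 1) +
      (∑ T ∈ S.box, weight F k T + ∑ T ∈ S.imp, weight F k T)

section weight
variable {F A : Formula At} {S T U : Sequent At} {k : ℕ}

theorem weight_lt_of_lacking (h : lacking F T < lacking F S) (hb : T.box = S.box)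
    (hi : T.imp = S.imp) : weight F (k + 1) T < weight F (k + 1) S := by
  rw [weight, weight, hb, hi]
  have := Nat.mul_lt_mul_of_pos_right h (Nat.succ_pos ((Uni F).sup (weight F k)))
  rw [Nat.succ_eq_add_one] at this
  omega

theorem sum_insert_le (f : Sequent At → ℕ) (s : Finset (Sequent At)) (T : Sequent At) :
    ∑ U ∈ insert T s, f U ≤ f T + ∑ U ∈ s, f U := by
  by_cases h : T ∈ s
  · rw [Finset.insert_eq_of_mem h]; omega
  · rw [Finset.sum_insert h]

theorem weight_addBox_lt (hU : U ∈ Uni F) (h : lacking F (S.addBox U) < lacking F S) :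
    weight F (k + 1) (S.addBox U) < weight F (k + 1) S := by
  rw [weight, weight, box_addBox, imp_addBox]
  have h1 := Nat.mul_le_mul_right ((Uni F).sup (weight F k) + 1) h
  rw [Nat.succ_mul] at h1
  have h2 := sum_insert_le (weight F k) S.box U
  have h3 := Finset.le_sup (f := weight F k) hU
  omega

theorem weight_addImp_lt (hU : U ∈ Uni F) (h : lacking F (S.addImp U) < lacking F S) :
    weight F (k + 1) (S.addImp U) < weight F (k + 1) S := by
  rw [weight, weight, box_addImp, imp_addImp]
  have h1 := Nat.mul_le_mul_right ((Uni F).sup (weight F k) + 1) h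
  rw [Nat.succ_mul] at h1
  have h2 := sum_insert_le (weight F k) S.imp U
  have h3 := Finset.le_sup (f := weight F k) hU
  omega

theorem weight_fill_lt {G : Context At} (hG : G.Fresh T) (hTU : T.Le U) {n : ℕ}
    (h : ∀ j, n < j → weight F j U < weight F j T) (hk : n + G.len < k) :
    weight F k (G.fill U) < weight F k (G.fill T) := by
  induction G generalizing k with
  | hole => exact h k (by simpa [Context.len] using hk)
  | imp S G ih =>
    rw [Context.len] at hk
    obtain ⟨k, rfl⟩ : ∃ l, k = l + 1 := ⟨k - 1, by omega⟩
    have h0 := ih hG.2 (k := k) (by omega)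
    have h1 := Nat.mul_le_mul_right ((Uni F).sup (weight F k) + 1)
      (lacking_mono (F := F) (Le.fill (.imp S G) hTU))
    rw [weight, weight]
    simp only [Context.fill, box_addImp, imp_addImp] at h1 ⊢
    rw [Finset.sum_insert hG.1]
    have h2 := sum_insert_le (weight F k) S.imp (G.fill U)
    omega
  | box S G ih =>
    rw [Context.len] at hk
    obtain ⟨k, rfl⟩ : ∃ l, k = l + 1 := ⟨k - 1, by omega⟩
    have h0 := ih hG.2 (k := k) (by omega)
    have h1 := Nat.mul_le_mul_right ((Uni F).sup (weight F k) + 1)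
      (lacking_mono (F := F) (Le.fill (.box S G) hTU))
    rw [weight, weight]
    simp only [Context.fill, box_addBox, imp_addBox] at h1 ⊢
    rw [Finset.sum_insert hG.1]
    have h2 := sum_insert_le (weight F k) S.box (G.fill U)
    omega

end weight


/-! ### Saturating a component without implication blocks -/

/-- A possible effect of a search step on a component without implication blocks: `T` is larger
than `S` and lighter, within the same bound. -/
structure Grow (F : Formula At) (n : ℕ) (S T : Sequent At) : Prop where
  le : S.Le T
  bdd : Bdd F n T
  impFree : T.ImpFree
  lt : ∀ j, n < j → weight F j T < weight F j S

section grow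
variable {F : Formula At} {n : ℕ} {S T U : Sequent At}

theorem Grow.of_labels (hle : S.Le T) (hb : Bdd F n T) (hi : T.ImpFree) (hbox : T.box = S.box)
    (himp : T.imp = S.imp) {r : Req At} (hr : r ∈ reqs F) (hS : ¬ r.Met S) (hT : r.Met T) :
    Grow F n S T := by
  refine ⟨hle, hb, hi, fun j hj => ?_⟩
  obtain ⟨k, rfl⟩ : ∃ k, j = k + 1 := ⟨j - 1, by omega⟩
  exact weight_lt_of_lacking (lacking_lt hle hr hS hT) hbox himp

theorem Grow.addL {A : Formula At} (hn : n ≤ F.deg) (hb : Bdd F n S) (hi : S.ImpFree)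
    (hA : A ∈ Lab F n) (h : A ∉ S.ant) : Grow F n S (S.addL A) :=
  .of_labels (.addL S A) (hb.addL hA) hi.addL (by simp) (by simp)
    (ant_mem_reqs (lab_mono hn hA)) h (by simp [Req.Met])

theorem Grow.addR {A : Formula At} (hn : n ≤ F.deg) (hb : Bdd F n S) (hi : S.ImpFree)
    (hA : A ∈ Lab F n) (h : A ∉ S.fml) : Grow F n S (S.addR A) :=
  .of_labels (.addR S A) (hb.addR hA) hi.addR (by simp) (by simp)
    (fml_mem_reqs (lab_mono hn hA)) h (by simp [Req.Met])

theorem Grow.addBox (hn : n ≤ F.deg) (hb : Bdd F n S) (hi : S.ImpFree) (hpos : 1 ≤ n)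
    (hU : Bdd F (n - 1) U) (hUi : U.ImpFree) {r : Req At} (hr : r ∈ reqs F) (hS : ¬ r.Met S)
    (hT : r.Met (S.addBox U)) : Grow F n S (S.addBox U) := by
  refine ⟨.addBox S U, hb.addBox hpos hU, hi.addBox hUi, fun j hj => ?_⟩
  obtain ⟨k, rfl⟩ : ∃ k, j = k + 1 := ⟨j - 1, by omega⟩
  exact weight_addBox_lt (mem_uni.2 ⟨hU.mono (by omega), hUi⟩) (lacking_lt (.addBox S U) hr hS hT)

/-- Growth inside a component is growth of the whole. -/
theorem Grow.exists_context (hb : Bdd F n S) (hi : S.ImpFree) (hT : T.InPlus S) :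
    ∃ (G : Context At) (m : ℕ), G.fill T = S ∧ m ≤ n ∧ Bdd F m T ∧
      ∀ U, Grow F m T U → Grow F n S (G.fill U) := by
  obtain ⟨G, m, rfl, hf, hm, hbT, hbU, hfree⟩ := hb.exists_context hT
  obtain ⟨hlen, hfree⟩ := hfree hi
  exact ⟨G, m, rfl, hm, hbT, fun U hU => ⟨.fill G hU.le, hbU U hU.bdd, hfree U hU.impFree,
    fun j hj => weight_fill_lt hf hU.le hU.lt (by omega)⟩⟩

/-- If a component violates the condition of one of the rules (R1) then this rule can be applied
to it, and all premises are larger. -/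
theorem exists_R1_rule (hn : n ≤ F.deg) (hb : Bdd F n S) (hi : S.ImpFree) (hax : ¬ IsAxiom S)
    (h1 : ¬ S.CondR1) : ∃ r : Rule At, r.concl = S ∧ r.Side ∧ ¬ r.Redundant ∧
      (∀ G, r.Stage G) ∧ ∀ T ∈ r.prems, Grow F n S T := by
  by_contra hno
  refine h1 ⟨fun h => hax (isAxiom_of_bot_mem h), fun h => hax (isAxiom_of_top_mem h),
    fun p h => hax (isAxiom_of_mem h.1 h.2), ?_, ?_, ?_, ?_, ?_, ?_, ?_, ?_⟩
  · intro A B h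
    by_contra! hc
    have e := addR_of_mem h
    have hl := lab_and (hb.fml_subset h)
    refine hno ⟨.andR S A B, e, trivial, ?_, fun _ => trivial, ?_⟩
    · simpa [Rule.Redundant, Rule.concl, e] using hc
    · simp only [Rule.prems, e, List.mem_cons, List.not_mem_nil, or_false, forall_eq_or_imp,
        forall_eq]
      exact ⟨.addR hn hb hi hl.1 hc.1, .addR hn hb hi hl.2 hc.2⟩
  · intro A B h
    by_contra hc
    have e := addL_of_mem h
    have hl := lab_and (hb.ant_subset h)
    refine hno ⟨.andL S A B, e, trivial, ?_, fun _ => trivial, ?_⟩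
    · simpa [Rule.Redundant, Rule.concl, e] using hc
    · simp only [Rule.prems, e, List.mem_cons, List.not_mem_nil, or_false, forall_eq]
      have hle : S.Le ((S.addL B).addL A) := (Le.addL S B).trans (.addL _ A)
      have hb' := (hb.addL hl.2).addL hl.1
      by_cases hA : A ∈ S.ant
      · exact .of_labels hle hb' hi.addL.addL (by simp) (by simp)
          (ant_mem_reqs (lab_mono hn hl.2)) (fun hB => hc ⟨hA, hB⟩) (by simp [Req.Met])
      · exact .of_labels hle hb' hi.addL.addL (by simp) (by simp)
          (ant_mem_reqs (lab_mono hn hl.1)) hA (by simp [Req.Met])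
  · intro A B h
    by_contra hc
    have e := addR_of_mem h
    have hl := lab_or (hb.fml_subset h)
    refine hno ⟨.orR S A B, e, trivial, ?_, fun _ => trivial, ?_⟩
    · simpa [Rule.Redundant, Rule.concl, e] using hc
    · simp only [Rule.prems, e, List.mem_cons, List.not_mem_nil, or_false, forall_eq]
      have hle : S.Le ((S.addR A).addR B) := (Le.addR S A).trans (.addR _ B)
      have hb' := (hb.addR hl.1).addR hl.2
      by_cases hA : A ∈ S.fml
      · exact .of_labels hle hb' hi.addR.addR (by simp) (by simp)
          (fml_mem_reqs (lab_mono hn hl.2)) (fun hB => hc ⟨hA, hB⟩) (by simp [Req.Met])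
      · exact .of_labels hle hb' hi.addR.addR (by simp) (by simp)
          (fml_mem_reqs (lab_mono hn hl.1)) hA (by simp [Req.Met])
  · intro A B h
    by_contra! hc
    have e := addL_of_mem h
    have hl := lab_or (hb.ant_subset h)
    refine hno ⟨.orL S A B, e, trivial, ?_, fun _ => trivial, ?_⟩
    · simpa [Rule.Redundant, Rule.concl, e] using hc
    · simp only [Rule.prems, e, List.mem_cons, List.not_mem_nil, or_false, forall_eq_or_imp,
        forall_eq]
      exact ⟨.addL hn hb hi hl.1 hc.1, .addL hn hb hi hl.2 hc.2⟩
  · intro A B h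
    by_contra! hc
    have e := addL_of_mem h
    have hl := lab_imp (hb.ant_subset h)
    refine hno ⟨.impL S A B, e, trivial, ?_, fun _ => trivial, ?_⟩
    · simpa [Rule.Redundant, Rule.concl, e] using hc
    · simp only [Rule.prems, e, List.mem_cons, List.not_mem_nil, or_false, forall_eq_or_imp,
        forall_eq]
      exact ⟨.addR hn hb hi hl.1 hc.1, .addL hn hb hi hl.2 hc.2⟩
  · intro A h T hT
    by_contra hc
    have e : ((S.eraseBox T).addL (.box A)).addBox T = S := by
      rw [addL_of_mem (by simpa using h), eraseBox_addBox hT]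
    have hl := lab_box (hb.ant_subset h)
    refine hno ⟨.boxL (S.eraseBox T) A T, e, trivial, hc, fun _ => trivial, ?_⟩
    simp only [Rule.prems, List.mem_cons, List.not_mem_nil, or_false, forall_eq]
    rw [addL_of_mem (S := S.eraseBox T) (by simpa using h)]
    have g := Grow.addL (by omega) (hb.of_box hT) ((impFree_iff.1 hi).2 T hT) hl.2 hc
    refine ⟨?_, hb.eraseBox.addBox hl.1 g.bdd, hi.eraseBox.addBox g.impFree, fun j hj => ?_⟩
    · conv_lhs => rw [← eraseBox_addBox hT]
      exact .addBox_congr _ g.le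
    · conv_rhs => rw [← eraseBox_addBox hT]
      exact weight_fill_lt (G := .box (S.eraseBox T) .hole) ⟨by simp [Context.fill], trivial⟩
        g.le g.lt (by simp only [Context.len]; omega)
  · intro A h T hT
    by_contra hc
    have e : ((S.eraseBox T).addR (.dia A)).addBox T = S := by
      rw [addR_of_mem (by simpa using h), eraseBox_addBox hT]
    have hl := lab_dia (hb.fml_subset h)
    refine hno ⟨.diaR (S.eraseBox T) A T, e, trivial, hc, fun _ => trivial, ?_⟩
    simp only [Rule.prems, List.mem_cons, List.not_mem_nil, or_false, forall_eq]
    rw [addR_of_mem (S := S.eraseBox T) (by simpa using h)]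
    have g := Grow.addR (by omega) (hb.of_box hT) ((impFree_iff.1 hi).2 T hT) hl.2 hc
    refine ⟨?_, hb.eraseBox.addBox hl.1 g.bdd, hi.eraseBox.addBox g.impFree, fun j hj => ?_⟩
    · conv_lhs => rw [← eraseBox_addBox hT]
      exact .addBox_congr _ g.le
    · conv_rhs => rw [← eraseBox_addBox hT]
      exact weight_fill_lt (G := .box (S.eraseBox T) .hole) ⟨by simp [Context.fill], trivial⟩
        g.le g.lt (by simp only [Context.len]; omega)
  · intro A h
    by_contra hc
    have e := addL_of_mem h
    have hl := lab_dia (hb.ant_subset h)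
    refine hno ⟨.diaL S A, e, trivial, ?_, fun _ => trivial, ?_⟩
    · simpa [Rule.Redundant, Rule.concl, e] using hc
    · simp only [Rule.prems, e, List.mem_cons, List.not_mem_nil, or_false, forall_eq]
      exact .addBox hn hb hi hl.1 (bdd_empty.addL hl.2) impFree_empty.addL
        (dia_mem_reqs (lab_mono (by omega) hl.2)) hc ⟨empty.addL A, by simp, by simp⟩

end grow

/-- The saturation conditions that depend on the formulas and modal blocks only: those of the
rules (R1), and that of the rule `(⊃_R)` for implications whose premise is in the antecedent. -/
structure Sequent.LocalSat (S : Sequent At) : Prop where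
  r1 : S.CondR1
  imp : ∀ A B, Formula.imp A B ∈ S.fml → A ∈ S.ant → B ∈ S.fml

theorem Sequent.LocalSat.congr {S T : Sequent At} (h : S.LocalSat) (e : S.sharp = T.sharp) :
    T.LocalSat := by
  refine ⟨?_, ?_⟩
  · rw [← condR1_sharp_iff, ← e, condR1_sharp_iff]; exact h.r1
  · rw [← ant_eq_of_sharp_eq e, ← fml_eq_of_sharp_eq e]; exact h.imp

/-- All components, blocked ones included, satisfy all conditions except possibly those of the
rules for `⊃` and `□` that create implication blocks. -/
def Sequent.Stable (S : Sequent At) : Prop := ∀ T : Sequent At, T.InPlus S → T.LocalSat ∧ T.CondR2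

theorem Sequent.Stable.globalR2Saturated {S : Sequent At} (h : S.Stable) (hax : ¬ IsAxiom S) :
    S.GlobalR2Saturated :=
  ⟨hax, fun T hT => .inl ⟨⟨fun h => hax (h.of_inPlus hT), condR1_sharp_iff.2 (h T hT).1.r1⟩,
    (h T hT).2⟩⟩

/-- The premise of a search step that has only one. -/
theorem Reach.single {P : Sequent At → Prop} (G : Context At) (r : Rule At) {T : Sequent At}
    (hs : r.Side) (hok : SearchStep G r) (hp : r.prems = [T]) (h : Reach P (G.fill T)) :
    Reach P (G.fill r.concl) :=
  .node G r hs hok (by simpa [hp] using h)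

/-- Saturation of a component `C` without implication blocks. All other components of `G{C}` are
locally saturated; `Par C` says that the parent of `C`, if it has one, satisfies the conditions
of (trans) and (inter), and `hpar` that otherwise one of these rules can be applied. -/
theorem reach_stable {F : Formula At} {n : ℕ} (hn : n ≤ F.deg) (G : Context At)
    (Par : Sequent At → Prop)
    (hctx : ∀ C X : Sequent At, C.ImpFree → X.InPlus (G.fill C) →
      X.InPlus C ∨ X.LocalSat ∧ (Par C → X.CondR2))
    (hpar : ∀ C : Sequent At, C.ImpFree → Bdd F n C → (G.fill C).GlobalR1Saturated → ¬ Par C →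
      ∃ C', Grow F n C C' ∧ ∀ P, Reach P (G.fill C') → Reach P (G.fill C))
    (C : Sequent At) (hC : C.ImpFree) (hb : Bdd F n C) :
    Reach (fun S => IsAxiom S ∨ ∃ C' : Sequent At, S = G.fill C' ∧ C.Le C' ∧ Bdd F n C' ∧
      C'.ImpFree ∧ (G.fill C').Stable) (G.fill C) := by
  induction hw : weight F (F.deg + 1) C using Nat.strong_induction_on generalizing C with
  | _ w ih =>
    subst hw
    have ih' : ∀ C', Grow F n C C' → Reach (fun S => IsAxiom S ∨ ∃ C' : Sequent At,
        S = G.fill C' ∧ C.Le C' ∧ Bdd F n C' ∧ C'.ImpFree ∧ (G.fill C').Stable) (G.fill C') := by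
      intro C' g
      refine (ih _ (g.lt _ (by omega)) C' g.impFree g.bdd rfl).bind fun S hS => .leaf ?_
      exact hS.imp_right fun ⟨D, h1, h2, h3⟩ => ⟨D, h1, g.le.trans h2, h3⟩
    by_cases hax : IsAxiom (G.fill C)
    · exact .leaf (.inl hax)
    have hax' : ∀ X : Sequent At, X.InPlus (G.fill C) → ¬ IsAxiom X :=
      fun X hX h => hax (h.of_inPlus hX)
    have hCG : ∀ X : Sequent At, X.InPlus C → X.InPlus (G.fill C) :=
      fun X hX => Relation.ReflTransGen.trans hX (G.inPlus_fill C)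
    -- a rule (R1) applies in `C`
    by_cases h1 : ∃ X : Sequent At, X.InPlus C ∧ ¬ X.CondR1
    · obtain ⟨X, hX, h1⟩ := h1
      obtain ⟨H, m, hH, hm, hbX, hg⟩ := Grow.exists_context hb hC hX
      obtain ⟨r, hr, hs, hred, hst, hp⟩ := exists_R1_rule (hm.trans hn) hbX (hC.of_inPlus hX)
        (hax' X (hCG X hX)) h1
      have e : (G.comp H).fill r.concl = G.fill C := by rw [Context.fill_comp, hr, hH]
      rw [← e]
      refine .node _ r hs ⟨by rwa [e], hred, hst _⟩ fun T hT => ?_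
      rw [Context.fill_comp]
      exact ih' _ (hg T (hp T hT))
    push Not at h1
    have hR1 : ∀ X : Sequent At, X.InPlus (G.fill C) → X.CondR1 := fun X hX =>
      (hctx C X hC hX).elim (h1 X) fun h => h.1.r1
    have hG1 : (G.fill C).GlobalR1Saturated :=
      ⟨hax, fun X hX => .inl ⟨hax' X hX, condR1_sharp_iff.2 (hR1 X hX)⟩⟩
    -- (trans) or (inter) applies at the parent
    by_cases h2 : Par C
    swap
    · obtain ⟨C', hg, hC'⟩ := hpar C hC hb hG1 h2
      exact hC' _ (ih' C' hg)
    have hR2 : ∀ X : Sequent At, X.InPlus (G.fill C) → X.CondR2 := fun X hX =>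
      (hctx C X hC hX).elim
        (fun h => condR2_iff.2 fun T hT => by
          rw [(impFree_iff.1 (hC.of_inPlus h)).1] at hT; simp at hT)
        fun h => h.2 h2
    have hG2 : (G.fill C).GlobalR2Saturated :=
      ⟨hax, fun X hX => .inl ⟨⟨hax' X hX, condR1_sharp_iff.2 (hR1 X hX)⟩, hR2 X hX⟩⟩
    -- the rule for `⊃` that adds no block applies in `C`
    by_cases h3 : ∃ X : Sequent At, X.InPlus C ∧ ¬ X.LocalSat
    · obtain ⟨X, hX, h3⟩ := h3
      have himp : ∃ A B, Formula.imp A B ∈ X.fml ∧ A ∈ X.ant ∧ B ∉ X.fml := by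
        by_contra! hc
        exact h3 ⟨h1 X hX, hc⟩
      obtain ⟨A, B, hAB, hA, hB⟩ := himp
      obtain ⟨H, m, hH, hm, hbX, hg⟩ := Grow.exists_context hb hC hX
      have hXf := hC.of_inPlus hX
      have e0 := addR_of_mem hAB
      have e : (G.comp H).fill (Rule.impR₁ X A B).concl = G.fill C := by
        rw [Context.fill_comp, Rule.concl, e0, hH]
      rw [← e]
      refine .single _ _ (T := X.addR B) hA ⟨by rwa [e], ?_, ?_, ?_⟩ (by simp [Rule.prems, e0]) ?_
      · simp only [Rule.Redundant, Rule.concl, e0, SatImpR, (impFree_iff.1 hXf).1]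
        simpa using fun _ => hB
      · rwa [e]
      · -- a component equivalent to `X` that is R3-saturated would be locally saturated
        rw [e, Rule.concl, e0]
        rintro ⟨Y, hY, hY3, -, -, he⟩
        refine h3 (LocalSat.congr ?_ he)
        rcases hctx C Y hC hY with h | h
        · refine ⟨hR1 Y hY, fun A B hAB hA => ?_⟩
          rcases hY3.2.impR A B hAB with h' | ⟨T, hT, -⟩
          · exact h'.2
          · rw [(impFree_iff.1 (hC.of_inPlus h)).1] at hT; simp at hT
        · exact h.1
      · rw [Context.fill_comp]
        exact ih' _ (hg _ (.addR (hm.trans hn) hbX hXf (lab_imp (hbX.fml_subset hAB)).2 hB))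
    push Not at h3
    refine .leaf (.inr ⟨C, rfl, .refl C, hb, hC, fun X hX => ⟨?_, hR2 X hX⟩⟩)
    exact (hctx C X hC hX).elim (h3 X) fun h => h.1


/-! ### Replacing a component -/

/-- `X'` corresponds to `X` when a component `T` of a sequent is replaced by `T'`: either they are
equal, or the replacement takes place inside `X`. -/
def Repl (T T' X X' : Sequent At) : Prop :=
  X = X' ∨ ∃ G : Context At, X = G.fill T ∧ X' = G.fill T'

section repl
variable {S T T' C X X' Y Y' : Sequent At} {G : Context At}

theorem Repl.sharp_eq (h : Repl T T' X X') (e : T.sharp = T'.sharp) : X.sharp = X'.sharp := by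
  rcases h with rfl | ⟨G, rfl, rfl⟩
  exacts [rfl, G.sharp_fill_congr e]

theorem Repl.le (h : Repl T T' X X') (e : T.Le T') : X.Le X' := by
  rcases h with rfl | ⟨G, rfl, rfl⟩
  exacts [.refl _, .fill G e]

theorem Repl.condR3 (h : Repl T (T.addImp C) X X') (hX : X.CondR3) : X'.CondR3 := by
  rw [condR3_iff] at hX ⊢
  intro A hA
  rw [← fml_eq_of_sharp_eq (h.sharp_eq (sharp_addImp T C).symm)] at hA
  exact (hX A hA).mono (h.le (.addImp T C))

/-- Each component of `G{T, ⟨C⟩}` is a component of `C` or corresponds to one of `G{T}`. -/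
theorem exists_repl_of_inPlus (h : X'.InPlus (G.fill (T.addImp C))) :
    X'.InPlus C ∨ ∃ X : Sequent At, X.InPlus (G.fill T) ∧ Repl T (T.addImp C) X X' := by
  induction G with
  | hole =>
    rcases inPlus_iff.1 h with rfl | ⟨U, hU, hX⟩ | ⟨U, hU, hX⟩
    · exact .inr ⟨T, .refl, .inr ⟨.hole, rfl, rfl⟩⟩
    · simp only [Context.fill, imp_addImp, Finset.mem_insert] at hU
      rcases hU with rfl | hU
      · exact .inl hX
      · exact .inr ⟨X', hX.imp hU, .inl rfl⟩
    · simp only [Context.fill, box_addImp] at hU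
      exact .inr ⟨X', hX.box hU, .inl rfl⟩
  | imp S G ih =>
    rcases inPlus_iff.1 h with rfl | ⟨U, hU, hX⟩ | ⟨U, hU, hX⟩
    · exact .inr ⟨_, .refl, .inr ⟨.imp S G, rfl, rfl⟩⟩
    · simp only [Context.fill, imp_addImp, Finset.mem_insert] at hU
      rcases hU with rfl | hU
      · exact (ih hX).imp_right fun ⟨X, hX, h⟩ => ⟨X, hX.imp (by simp [Context.fill]), h⟩
      · exact .inr ⟨X', hX.imp (by simp [Context.fill, hU]), .inl rfl⟩
    · simp only [Context.fill, box_addImp] at hU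
      exact .inr ⟨X', hX.box (by simp [Context.fill, hU]), .inl rfl⟩
  | box S G ih =>
    rcases inPlus_iff.1 h with rfl | ⟨U, hU, hX⟩ | ⟨U, hU, hX⟩
    · exact .inr ⟨_, .refl, .inr ⟨.box S G, rfl, rfl⟩⟩
    · simp only [Context.fill, imp_addBox] at hU
      exact .inr ⟨X', hX.imp (by simp [Context.fill, hU]), .inl rfl⟩
    · simp only [Context.fill, box_addBox, Finset.mem_insert] at hU
      rcases hU with rfl | hU
      · exact (ih hX).imp_right fun ⟨X, hX, h⟩ => ⟨X, hX.box (by simp [Context.fill]), h⟩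
      · exact .inr ⟨X', hX.box (by simp [Context.fill, hU]), .inl rfl⟩

theorem Repl.exists_of_mem_imp (h : Repl T (T.addImp C) X X') (hY : Y' ∈ X'.imp) :
    (Y' = C ∧ X = T ∧ X' = T.addImp C) ∨ ∃ Y ∈ X.imp, Repl T (T.addImp C) Y Y' := by
  rcases h with rfl | ⟨G, rfl, rfl⟩
  · exact .inr ⟨Y', hY, .inl rfl⟩
  cases G with
  | hole =>
    simp only [Context.fill, imp_addImp, Finset.mem_insert] at hY
    rcases hY with rfl | hY
    · exact .inl ⟨rfl, rfl, rfl⟩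
    · exact .inr ⟨Y', hY, .inl rfl⟩
  | imp S G =>
    simp only [Context.fill, imp_addImp, Finset.mem_insert] at hY
    rcases hY with rfl | hY
    · exact .inr ⟨G.fill T, by simp [Context.fill], .inr ⟨G, rfl, rfl⟩⟩
    · exact .inr ⟨Y', by simp [Context.fill, hY], .inl rfl⟩
  | box S G =>
    simp only [Context.fill, imp_addBox] at hY
    exact .inr ⟨Y', by simp [Context.fill, hY], .inl rfl⟩

theorem Repl.exists_of_inImp (hC : C.imp = ∅) (hY : Y'.imp.Nonempty) (h : Y'.InImp X')
    (hX : Repl T (T.addImp C) X X') :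
    ∃ Y : Sequent At, Y.InImp X ∧ Repl T (T.addImp C) Y Y' := by
  induction h generalizing X with
  | single h =>
    rcases hX.exists_of_mem_imp h with ⟨rfl, -⟩ | ⟨Y, hYX, hr⟩
    · simp [hC] at hY
    · exact ⟨Y, .single hYX, hr⟩
  | tail h h' ih =>
    rcases hX.exists_of_mem_imp h' with ⟨rfl, -⟩ | ⟨Z, hZX, hr⟩
    · have := InImp.imp_nonempty h
      simp [hC] at this
    · obtain ⟨Y, hYZ, hY⟩ := ih hr
      exact ⟨Y, .tail hYZ hZX, hY⟩

theorem Repl.imp_nonempty (h : Repl T T' X X') (hX' : X'.imp.Nonempty) :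
    X = T ∨ X.imp.Nonempty := by
  rcases h with rfl | ⟨G, rfl, rfl⟩
  · exact .inr hX'
  cases G with
  | hole => exact .inl rfl
  | imp S G => exact .inr ⟨G.fill T, by simp [Context.fill]⟩
  | box S G => simp only [Context.fill, imp_addBox] at hX' ⊢; exact .inr hX'

end repl

/-! ### Termination of proof search -/

/-- Implication blocks are created top-down and without repetition: above a component that has
implication blocks of its own, in the same chain of implication blocks, all components are
saturated, and none of them is `≃`-equivalent to it. -/
def Sequent.TopDown (S : Sequent At) : Prop :=
  ∀ X Y : Sequent At, X.InPlus S → Y.InImp X → Y.imp.Nonempty → X.CondR3 ∧ X.sharp ≠ Y.sharp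

theorem Sequent.TopDown.addImp {G : Context At} {T C : Sequent At} (h : (G.fill T).TopDown)
    (hT : ∀ X : Sequent At, X.InPlus (G.fill T) → T.InImp X → X.CondR3 ∧ X.sharp ≠ T.sharp)
    (hC : C.ImpFree) : (G.fill (T.addImp C)).TopDown := by
  intro X' Y' hX' hY' hne
  have hCi := (impFree_iff.1 hC).1
  rcases exists_repl_of_inPlus hX' with hX' | ⟨X, hX, hr⟩
  · -- components of `C` have no implication blocks
    have := hY'.imp_nonempty
    rw [(impFree_iff.1 (hC.of_inPlus hX')).1] at this
    simp at this
  obtain ⟨Y, hY, hr'⟩ := hr.exists_of_inImp hCi hne hY'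
  have e := (sharp_addImp T C).symm
  rw [← hr.sharp_eq e, ← hr'.sharp_eq e]
  have : X.CondR3 ∧ X.sharp ≠ Y.sharp := by
    rcases hr'.imp_nonempty hne with rfl | hne
    exacts [hT X hX hY, h X Y hX hY hne]
  exact ⟨hr.condR3 this.1, this.2⟩

/-- A bound for the depth at which implication blocks occur: there are at most `m` nested modal
blocks, and between two of them a chain of implication blocks without repetition. The set `P`
collects what has been met on the current chain. -/
theorem Context.len_add_card_le {F : Formula At} {m : ℕ} (hm : m ≤ F.deg) {G : Context At}
    {T : Sequent At} (hb : Bdd F m (G.fill T)) (h : (G.fill T).TopDown)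
    {P : Finset (Sequent At)} (hP : P ⊆ Uni F)
    (hd : ∀ Y : Sequent At, Y = G.fill T ∨ Y.InImp (G.fill T) → Y.imp.Nonempty → Y.sharp ∉ P) :
    G.len + P.card ≤ m * ((Uni F).card + 1) + (Uni F).card := by
  induction G generalizing m P with
  | hole =>
    have := Finset.card_le_card hP
    simp only [len]
    omega
  | imp S G ih =>
    have hmem : G.fill T ∈ (fill (.imp S G) T).imp := by simp [fill]
    have hS := hd _ (.inl rfl) ⟨_, hmem⟩
    have hin : ∀ Y : Sequent At, Y = G.fill T ∨ Y.InImp (G.fill T) →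
        Y.InImp (fill (.imp S G) T) := by
      rintro Y (rfl | hY)
      exacts [.single hmem, .tail hY hmem]
    have := ih hm (hb.of_imp hmem) (fun X Y hX => h X Y (hX.imp hmem))
      (P := insert (fill (.imp S G) T).sharp P)
      (Finset.insert_subset (hb.sharp_mem_uni hm) hP) fun Y hY hne => by
        rw [Finset.mem_insert, not_or]
        exact ⟨((h _ Y .refl (hin Y hY) hne).2).symm, hd Y (.inr (hin Y hY)) hne⟩
    rw [Finset.card_insert_of_notMem hS] at this
    simp only [len]
    omega
  | box S G ih =>
    have hmem : G.fill T ∈ (fill (.box S G) T).box := by simp [fill]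
    have hpos := hb.pos hmem
    have := ih (by omega) (hb.of_box hmem) (fun X Y hX => h X Y (hX.box hmem))
      (P := ∅) (by simp) (by simp)
    have hc := Finset.card_le_card hP
    obtain ⟨k, rfl⟩ : ∃ k, m = k + 1 := ⟨m - 1, by omega⟩
    simp only [len, Nat.add_sub_cancel, Finset.card_empty] at this ⊢
    rw [Nat.succ_mul]
    omega

/-- If a stable sequent is not global-saturated, then some component is neither blocked nor
R3-saturated, while those above it in its chain of implication blocks are R3-saturated. -/
theorem Sequent.TopDown.exists_unsaturated {S : Sequent At} (h : S.TopDown) (hst : S.Stable)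
    (hax : ¬ IsAxiom S) (hns : ¬ S.GlobalSaturated) :
    ∃ T : Sequent At, T.InPlus S ∧ ¬ T.Blocked S ∧ (∃ A ∈ T.fml, ¬ T.SatR A) ∧
      ∀ X : Sequent At, X.InPlus S → T.InImp X → X.CondR3 ∧ X.sharp ≠ T.sharp := by
  have hR2 : ∀ T : Sequent At, T.InPlus S → T.R2Saturated := fun T hT =>
    ⟨⟨fun h => hax (h.of_inPlus hT), condR1_sharp_iff.2 (hst T hT).1.r1⟩, (hst T hT).2⟩
  have hne : {T : Sequent At | T.InPlus S ∧ ¬ T.R3Saturated ∧ ¬ T.Blocked S}.Nonempty := by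
    by_contra! hc
    refine hns ⟨hax, fun T hT => ?_⟩
    by_contra! hT'
    exact (Set.eq_empty_iff_forall_notMem.1 hc T) ⟨hT, hT'⟩
  obtain ⟨T, ⟨hT, hT3, hTb⟩, hmax⟩ := Set.exists_max_image _ height
    ((finite_inPlus S).subset fun T hT => hT.1) hne
  refine ⟨T, hT, hTb, ?_, fun X hX hTX => ?_⟩
  · by_contra! hc
    exact hT3 ⟨hR2 T hT, condR3_iff.2 hc⟩
  have hX3 : X.R3Saturated := by
    by_contra hX3
    by_cases hXb : X.Blocked S
    · obtain ⟨Y, hY, -, hXY, -, he⟩ := hXb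
      exact (h Y X hY hXY hTX.imp_nonempty).2 he
    · exact absurd (hmax X ⟨hX, hX3, hXb⟩) (not_le.2 hTX.height_lt)
  exact ⟨hX3.2, fun he => hTb ⟨X, hX, hX3, hTX, ant_eq_of_sharp_eq he, he⟩⟩

/-- Application of a right rule for `⊃` or `□` that creates an implication block. -/
theorem exists_R3_rule {F : Formula At} {n : ℕ} {G : Context At} {T : Sequent At}
    (hst : (G.fill T).Stable) (hax : ¬ IsAxiom (G.fill T)) (hTb : ¬ T.Blocked (G.fill T))
    (hb : Bdd F n T) {A : Formula At} (hA : A ∈ T.fml) (hs : ¬ T.SatR A) :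
    ∃ C : Sequent At, Bdd F n C ∧ C.ImpFree ∧ (∀ D, C.Le D → (T.addImp D).SatR A) ∧
      ∀ P, Reach P (G.fill (T.addImp C)) → Reach P (G.fill T) := by
  have hG2 := hst.globalR2Saturated hax
  have e := addR_of_mem hA
  cases A with
  | imp A B =>
    have hAT : A ∉ T.ant := fun h => hs (.inl ⟨h, (hst T (G.inPlus_fill T)).1.imp A B hA h⟩)
    have hl := lab_imp (hb.fml_subset hA)
    refine ⟨(empty.addL A).addR B, (bdd_empty.addL hl.1).addR hl.2, impFree_empty.addL.addR,
      fun D hD => .inr ⟨D, by simp, hD.ant_subset (by simp), hD.fml_subset (by simp)⟩,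
      fun P hP => ?_⟩
    have e' : G.fill (Rule.impR₂ T A B).concl = G.fill T := by rw [Rule.concl, e]
    rw [← e']
    refine .single G _ hAT ⟨by rwa [e'], ?_, ?_⟩ (by simp [Rule.prems, e]) hP
    · simpa only [Rule.Redundant, Rule.concl, e, SatR] using hs
    · simpa only [Rule.Stage, Rule.concl, e] using ⟨hG2, hTb⟩
  | box A =>
    have hl := lab_box (hb.fml_subset hA)
    refine ⟨empty.addBox (empty.addR A), bdd_empty.addBox hl.1 (bdd_empty.addR hl.2),
      impFree_empty.addBox impFree_empty.addR, fun D hD => .inr ⟨D, by simp, ?_⟩, fun P hP => ?_⟩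
    · exact hD.exists_box (fun U V hUV h => hUV.fml_subset h) ⟨empty.addR A, by simp, by simp⟩
    have e' : G.fill (Rule.boxR T A).concl = G.fill T := by rw [Rule.concl, e]
    rw [← e']
    refine .single G _ trivial ⟨by rwa [e'], ?_, ?_⟩ (by simp [Rule.prems, e]) hP
    · simpa only [Rule.Redundant, Rule.concl, e, SatR] using hs
    · simpa only [Rule.Stage, Rule.concl, e] using ⟨hG2, hTb⟩
  | _ => exact (hs trivial).elim

/-- If the block `⟨C⟩` of `T` does not structurally include `T`, then (trans) or (inter) can be
applied to it. -/
theorem exists_R2_rule {F : Formula At} {n : ℕ} (hn : n ≤ F.deg) {G : Context At}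
    {T C : Sequent At} (hbT : Bdd F n T) (hC : C.ImpFree) (hb : Bdd F n C)
    (hG1 : (G.fill (T.addImp C)).GlobalR1Saturated) (h : ¬ StructIncl T C) :
    ∃ C', Grow F n C C' ∧
      ∀ P, Reach P (G.fill (T.addImp C')) → Reach P (G.fill (T.addImp C)) := by
  by_cases hant : T.ant ⊆ C.ant
  · have : ∃ U ∈ T.box, ∀ U' ∈ C.box, ¬ StructIncl U U' := by
      by_contra! hc
      exact h ((structIncl_iff _ _).2 ⟨hant, hc⟩)
    obtain ⟨U, hU, hUC⟩ := this
    have hbU := (hbT.of_box hU).star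
    refine ⟨C.addBox U.star, .addBox hn hb hC (hbT.pos hU) hbU U.impFree_star
      (inter_mem_reqs (mem_uni.2 ⟨hbU.mono (by omega), U.impFree_star⟩)) ?_ ?_, fun P hP => ?_⟩
    · rintro ⟨U', hU', h'⟩
      exact hUC U' hU' ((structIncl_star_right U).trans h')
    · exact ⟨U.star, by simp, .refl _⟩
    · have e (D : Sequent At) : (T.addImp D).addBox U = T.addImp D :=
        addBox_of_mem (by simpa using hU)
      have e' : G.fill (Rule.inter T C U).concl = G.fill (T.addImp C) := by rw [Rule.concl, e]
      rw [← e']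
      refine .single G _ trivial ⟨by rw [e']; exact hG1.1, ?_, by simpa only [Rule.Stage, e']⟩
        (by simp [Rule.prems, e]) hP
      rintro ⟨U', hU', h'⟩
      exact hUC U' hU' h'
  · obtain ⟨A, hA, hAC⟩ := Finset.not_subset.1 hant
    refine ⟨C.addSetL T.ant, .of_labels (.addSetL C _) (hb.addSetL hbT.ant_subset) hC.addSetL
      (by simp) (by simp) (ant_mem_reqs (lab_mono hn (hbT.ant_subset hA))) hAC
      (by simp [Req.Met, hA]), fun P hP => ?_⟩
    have e : T.addSetL T.ant = T := addSetL_of_subset subset_rfl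
    have e' : G.fill (Rule.trans T T.ant C).concl = G.fill (T.addImp C) := by rw [Rule.concl, e]
    rw [← e']
    exact .single G _ trivial ⟨by rw [e']; exact hG1.1, hant, by simpa only [Rule.Stage, e']⟩
      (by simp [Rule.prems, e]) hP

/-- Proof search can be completed from every stable sequent that has been built top-down. -/
theorem reach_globalSaturated {F : Formula At} (S : Sequent At) (hst : S.Stable)
    (htd : S.TopDown) (hb : Bdd F F.deg S) :
    Reach (fun S => IsAxiom S ∨ S.GlobalSaturated) S := by
  induction hw : weight F (F.deg * ((Uni F).card + 1) + (Uni F).card + 1) S using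
    Nat.strong_induction_on generalizing S with
  | _ w ih =>
    subst hw
    by_cases hax : IsAxiom S
    · exact .leaf (.inl hax)
    by_cases hgs : S.GlobalSaturated
    · exact .leaf (.inr hgs)
    obtain ⟨T, hT, hTb, ⟨A, hA, hsat⟩, habove⟩ := htd.exists_unsaturated hst hax hgs
    obtain ⟨G, n, rfl, hfresh, hn, hbT, hbU, -⟩ := hb.exists_context hT
    obtain ⟨C, hbC, hC, hCA, hstep⟩ := exists_R3_rule hst hax hTb hbT hA hsat
    refine hstep _ ?_
    have hfill (D : Sequent At) : (G.comp (.imp T .hole)).fill D = G.fill (T.addImp D) :=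
      G.fill_comp _ _
    rw [← hfill]
    -- the new block is saturated, which does not affect the other components
    refine (reach_stable hn (G.comp (.imp T .hole)) (StructIncl T) ?_ ?_ C hC hbC).bind ?_
    · intro D X hD hX
      rw [hfill] at hX
      refine (exists_repl_of_inPlus hX).imp_right fun ⟨X₀, hX₀, hr⟩ => ?_
      have e := (sharp_addImp T D).symm
      refine ⟨(hst X₀ hX₀).1.congr (hr.sharp_eq e), fun hPar => condR2_iff.2 fun Y hY => ?_⟩
      rcases hr.exists_of_mem_imp hY with ⟨rfl, -, rfl⟩ | ⟨Y₀, hY₀, hr'⟩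
      · exact (structIncl_congr e rfl).1 hPar
      · exact (structIncl_congr (hr.sharp_eq e) (hr'.sharp_eq e)).1
          (condR2_iff.1 (hst X₀ hX₀).2 Y₀ hY₀)
    · intro D hD hbD hG1 hPar
      simp only [hfill] at hG1 ⊢
      exact exists_R2_rule hn hbT hD hbD hG1 hPar
    · rintro S' (hS' | ⟨D, rfl, hCD, hbD, hD, hst'⟩)
      · exact .leaf (.inl hS')
      rw [hfill] at hst' ⊢
      have htd' := htd.addImp habove hD
      have hb' := hbU _ (hbT.addImp hbD)
      refine ih _ (weight_fill_lt (n := 0) hfresh (.addImp T D) (fun j hj => ?_) ?_) _ hst' htd' hb'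
        rfl
      · obtain ⟨k, rfl⟩ : ∃ k, j = k + 1 := ⟨j - 1, by omega⟩
        exact weight_addImp_lt (mem_uni.2 ⟨hbD.mono hn, hD⟩) (lacking_lt (.addImp T D)
          (right_mem_reqs (lab_mono hn (hbT.fml_subset hA))) hsat (hCA D hCD))
      · have := G.len_add_card_le le_rfl hb' htd' (P := ∅) (by simp) (by simp)
        simp only [Finset.card_empty] at this
        omega

/-- Proof search for `⇒ A` can be completed. -/
theorem reach_goal (A : Formula At) :
    Reach (fun S => IsAxiom S ∨ S.GlobalSaturated) (goal A) := by
  have hfree : (goal A).ImpFree := impFree_empty.addR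
  have hb : Bdd A A.deg (goal A) := bdd_empty.addR (mem_lab.2 ⟨A.mem_sub_self, le_rfl⟩)
  refine (reach_stable (F := A) le_rfl .hole (fun _ => True) (fun C X _ hX => .inl hX)
    (fun C _ _ _ h => (h trivial).elim) (goal A) hfree hb).bind ?_
  rintro S (hS | ⟨C, rfl, -, hbC, hC, hst⟩)
  · exact .leaf (.inl hS)
  refine reach_globalSaturated _ hst (fun X Y hX hY _ => ?_) hbC
  have := hY.imp_nonempty
  rw [(impFree_iff.1 (hC.of_inPlus hX)).1] at this
  simp at this

/-- Proof search for an unprovable formula fails. -/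
theorem exists_failedSearch {A : Formula At} (h : ¬ Provable (goal A)) :
    ∃ L, FailedSearch A L := by
  obtain ⟨L, d, hL⟩ := reach_goal A
  refine ⟨L, d, hL, ?_⟩
  by_contra! hc
  exact h ⟨L, d.mono fun _ _ _ => trivial, fun T hT => (hL T hT).resolve_right (hc T hT)⟩

theorem finite_seqModel (S : Sequent At) : Finite (seqModel S).World :=
  (finite_inPlus S).to_subtype

/-- An unprovable formula has a finite countermodel. -/
theorem exists_countermodel {A : Formula At} (h : ¬ Provable (goal A)) :
    ∃ M : Model At, Finite M.World ∧ M.IsBirelational ∧ M.ForwardConfluent ∧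
      ∃ w : M.World, ¬ Forces M w A := by
  obtain ⟨L, d, -, S, hS, hgs⟩ := exists_failedSearch h
  exact ⟨seqModel S, finite_seqModel S, seqModel_isBirelational S, seqModel_forwardConfluent S,
    seqModelRoot S, not_forces_of_globalSaturated (d.mono fun _ _ _ => trivial) hS hgs⟩

end FIK

theorem mainTheorem2 {At : Type u} (A : FIK.Formula At) :
    -- completeness
    (FIK.Valid A → FIK.Provable (FIK.Sequent.goal A)) ∧
    -- an unprovable formula has a failed proof search, with a global-saturated leaf
    (¬ FIK.Provable (FIK.Sequent.goal A) → ∃ L, FIK.FailedSearch A L) ∧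
    -- every global-saturated leaf determines a finite countermodel
    (∀ L, FIK.CCDerivation (FIK.Sequent.goal A) L → ∀ S ∈ L, S.GlobalSaturated →
      Finite (FIK.seqModel S).World ∧
      (FIK.seqModel S).IsBirelational ∧
      (FIK.seqModel S).Hereditary ∧
      (FIK.seqModel S).ForwardConfluent ∧
      ¬ FIK.Forces (FIK.seqModel S) (FIK.seqModelRoot S) A) ∧
    -- finite model property
    (¬ FIK.Valid A → ∃ M : FIK.Model At,
      Finite M.World ∧ M.IsBirelational ∧ M.ForwardConfluent ∧
      ∃ w : M.World, ¬ FIK.Forces M w A) := by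
  refine ⟨fun hv => ?_, FIK.exists_failedSearch, fun L d S hS hgs => ?_,
    fun hv => FIK.exists_countermodel fun hp => hv (FIK.valid_of_provable hp)⟩
  · by_contra h
    obtain ⟨M, -, hM, hF, w, hw⟩ := FIK.exists_countermodel h
    exact hw (hv M hM hF w)
  · exact ⟨FIK.finite_seqModel S, FIK.seqModel_isBirelational S,
      (FIK.seqModel_isBirelational S).hereditary, FIK.seqModel_forwardConfluent S,
      FIK.not_forces_of_globalSaturated d hS hgs⟩
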